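/- Let $\mathfrak h$ be a finite-dimensional complex Hilbert space with scalar product $\langle\cdot,\cdot\rangle$ (linear in the second argument), $L:\mathfrak h\to\mathfrak h$ a symmetric linear operator and $w\in\mathfrak h$. Let $H^1(\mathbb R_+)=\{\phi\in L^2(\mathbb R_+):\phi'\in L^2(\mathbb R_+)\}$ and $H^2(\mathbb R_+)=\{\phi\in L^2(\mathbb R_+):\phi',\phi''\in L^2(\mathbb R_+)\}$ be the Sobolev spaces of complex-valued functions on $(0,+\infty)$ (weak derivatives), and for $\phi\in H^1(\mathbb R_+)$ let $\phi(0_+)$ be the value at $0$ of its representative that is continuous on $[0,+\infty)$. On the Hilbert space $L^2(\mathbb R_+)\oplus\mathfrak h$ let $$A_0(\phi,y):=(\phi'',Ly),\qquad D(A_0):=\{(\phi,y)\in H^2(\mathbb R_+)\oplus\mathfrak h:\phi'(0_+)=0\},$$ let $\tau:H^1(\mathbb R_+)\oplus\mathfrak h\to\mathbb C$, $\tau(\phi,y):=\phi(0_+)-\langle w,y\rangle$, and let $\dot A_0$ be the restriction of $A_0$ to $D(A_0)\cap\ker\tau$. Theorem. For any $\theta\in\mathbb R$ the linear operator $$A(\phi,y):=(\phi'',\,Ly+w\,\phi'(0_+)),\qquad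 D(A):=\{(\phi,y)\in H^2(\mathbb R_+)\oplus\mathfrak h:\theta\phi'(0_+)+\phi(0_+)=\langle w,y\rangle\}$$ is self-adjoint on $L^2(\mathbb R_+)\oplus\mathfrak h$ and extends $\dot A_0$. Moreover, for $z\in\mathbb C\setminus((-\infty,0]\cup\sigma(L))$ let $\sqrt z$ denote the square root with $\operatorname{Re}\sqrt z>0$ and put $$\Gamma(z):=-\Big(\frac1{\sqrt z}+\langle w,(-L+z)^{-1}w\rangle\Big),\qquad G_z:=\Big(\frac{e^{-\sqrt z\,x}}{\sqrt z},\,-(-L+z)^{-1}w\Big)\in L^2(\mathbb R_+)\oplus\mathfrak h.$$ Then every such $z$ belongs to the resolvent set $\rho(A_0)$; it belongs to $\rho(A)$ if and only if $\theta+\Gamma(z)\neq0$; and in that case $$(-A+z)^{-1}=(-A_0+z)^{-1}+(\theta+\Gamma(z))^{-1}\,G_z\otimes G_{z^*},$$ where $z^*$ is the complex conjugate of $z$ and $(a\otimes b)v:=\langle b,v\rangle\,a$, with the scalar product of $L^2(\mathbb R_+)\oplus\mathfrak h$. -/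

import Mathlib

open MeasureTheory Set
open scoped ContDiff ComplexConjugate

namespace GeneralizedLamb
noncomputable section

/-- Lebesgue measure on the half-line `(0, ∞)`. -/
abbrev halfLine : Measure ℝ := volume.restrict (Ioi (0 : ℝ))

/-- The complex Hilbert space `L²(ℝ₊)`. -/
abbrev L2 : Type := Lp ℂ 2 halfLine

/-- Test functions on the open half-line: smooth, with compact support contained in `(0, ∞)`. -/
def IsTest (η : ℝ → ℝ) : Prop :=
  ContDiff ℝ ∞ η ∧ HasCompactSupport η ∧ tsupport η ⊆ Ioi 0

/-- `g` is the weak (distributional) derivative of `f` on `(0, ∞)`. -/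
def IsWeakDeriv (f g : ℝ → ℂ) : Prop :=
  ∀ η : ℝ → ℝ, IsTest η → ∫ x, deriv η x • f x ∂halfLine = -∫ x, η x • g x ∂halfLine

theorem locInt_of_memLp {f : ℝ → ℂ} (hf : MemLp f 2 halfLine) : LocallyIntegrable f halfLine :=
  hf.locallyIntegrable (by norm_num)

theorem integrable_test {η : ℝ → ℝ} (hη : IsTest η) {f : ℝ → ℂ}
    (hf : LocallyIntegrable f halfLine) : Integrable (fun x => η x • f x) halfLine :=
  hf.integrable_smul_left_of_hasCompactSupport hη.1.continuous hη.2.1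

theorem integrable_deriv_test {η : ℝ → ℝ} (hη : IsTest η) {f : ℝ → ℂ}
    (hf : LocallyIntegrable f halfLine) : Integrable (fun x => deriv η x • f x) halfLine :=
  hf.integrable_smul_left_of_hasCompactSupport
    (hη.1.continuous_deriv (by simp)) hη.2.1.deriv

/-- A locally integrable function that is annihilated by all test functions vanishes. -/
theorem ae_zero_of_test {f : ℝ → ℂ} (hf : LocallyIntegrable f halfLine)
    (h : ∀ η : ℝ → ℝ, IsTest η → ∫ x, η x • f x ∂halfLine = 0) : f =ᵐ[halfLine] 0 := by
  have := IsOpen.ae_eq_zero_of_integral_contDiff_smul_eq_zero (μ := halfLine) (f := f)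
    isOpen_Ioi (U := Ioi (0 : ℝ)) (hf.locallyIntegrableOn _)
    (fun g h1 h2 h3 => h g ⟨h1, h2, h3⟩)
  filter_upwards [this, ae_restrict_mem measurableSet_Ioi] with x hx hx0 using hx hx0

/-- A smooth compactly supported function on `(0, ∞)` of integral zero has a test function as
primitive. -/
theorem exists_primitive {ψ : ℝ → ℝ} (hψ : IsTest ψ) (h0 : ∫ x, ψ x ∂halfLine = 0) :
    ∃ ζ : ℝ → ℝ, IsTest ζ ∧ deriv ζ = ψ := by
  obtain ⟨hs, hc, hsupp⟩ := hψ
  have hcont := hs.continuous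
  have hder : ∀ x, HasDerivAt (fun x => ∫ t in (0 : ℝ)..x, ψ t) (ψ x) x := fun x =>
    intervalIntegral.integral_hasDerivAt_right (hcont.intervalIntegrable _ _)
      hcont.stronglyMeasurable.stronglyMeasurableAtFilter hcont.continuousAt
  have hd : deriv (fun x => ∫ t in (0 : ℝ)..x, ψ t) = ψ := funext fun x => (hder x).deriv
  obtain ⟨a, b, ha, hab⟩ : ∃ a b : ℝ, 0 < a ∧ tsupport ψ ⊆ Icc a b := by
    rcases (tsupport ψ).eq_empty_or_nonempty with he | hne
    · exact ⟨1, 1, one_pos, by simp [he]⟩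
    · have hK : IsCompact (tsupport ψ) := hc
      obtain ⟨a, haK, ha⟩ := hK.exists_isLeast hne
      obtain ⟨b, hbK, hb⟩ := hK.exists_isGreatest hne
      exact ⟨a, b, hsupp haK, fun x hx => ⟨ha hx, hb hx⟩⟩
  have hz : ∀ x, x ∉ Icc a b → ψ x = 0 := fun x hx =>
    image_eq_zero_of_notMem_tsupport fun h => hx (hab h)
  have hzero : ∀ x, x ∉ Icc a b → ∫ t in (0 : ℝ)..x, ψ t = 0 := by
    intro x hx
    by_cases hxa : x < a
    · apply intervalIntegral.integral_zero_ae
      refine Filter.Eventually.of_forall fun t ht => hz t fun h => ?_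
      rw [mem_uIoc] at ht
      rcases ht with ht | ht <;> linarith [h.1, h.2, ht.1, ht.2]
    · have hxb : b < x := by
        by_contra hcon
        exact hx ⟨not_lt.1 hxa, not_lt.1 hcon⟩
      have hx0 : 0 ≤ x := by linarith [not_lt.1 hxa]
      rw [intervalIntegral.integral_of_le hx0]
      refine Eq.trans ?_ h0
      refine (setIntegral_eq_of_subset_of_forall_sdiff_eq_zero measurableSet_Ioi
        Ioc_subset_Ioi_self (fun t ht => hz t fun h => ht.2 ⟨ht.1, ?_⟩)).symm
      linarith [h.2]
  have hsub : tsupport (fun x => ∫ t in (0 : ℝ)..x, ψ t) ⊆ Icc a b := by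
    refine closure_minimal (fun x hx => ?_) isClosed_Icc
    by_contra hcon
    exact hx (hzero x hcon)
  refine ⟨_, ⟨?_, ?_, ?_⟩, hd⟩
  · rw [contDiff_infty_iff_deriv, hd]
    exact ⟨fun x => (hder x).differentiableAt, hs⟩
  · exact isCompact_Icc.of_isClosed_subset (isClosed_tsupport _) hsub
  · exact fun x hx => lt_of_lt_of_le ha (hsub hx).1

theorem exists_test_integral_one : ∃ η : ℝ → ℝ, IsTest η ∧ ∫ x, η x ∂halfLine = 1 := by
  let f : ContDiffBump (2 : ℝ) := ⟨1 / 2, 1, by norm_num, by norm_num⟩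
  have hsub : tsupport (f.normed volume) ⊆ Ioi (0 : ℝ) := by
    rw [f.tsupport_normed_eq]
    intro x hx
    rw [Metric.mem_closedBall, Real.dist_eq, abs_le] at hx
    have : f.rOut = 1 := rfl
    rw [mem_Ioi]
    linarith [hx.1]
  refine ⟨f.normed volume, ⟨f.contDiff_normed, f.hasCompactSupport_normed, hsub⟩, ?_⟩
  rw [setIntegral_eq_integral_of_forall_compl_eq_zero, f.integral_normed]
  exact fun x hx => image_eq_zero_of_notMem_tsupport fun h => hx (hsub h)

/-- A locally integrable function with vanishing weak derivative is constant. -/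
theorem ae_const_of_weakDeriv_zero {f : ℝ → ℂ} (hf : LocallyIntegrable f halfLine)
    (h : ∀ η : ℝ → ℝ, IsTest η → ∫ x, deriv η x • f x ∂halfLine = 0) :
    ∃ c : ℂ, f =ᵐ[halfLine] fun _ => c := by
  obtain ⟨ρ, hρ, hρ1⟩ := exists_test_integral_one
  refine ⟨∫ x, ρ x • f x ∂halfLine, ?_⟩
  set c := ∫ x, ρ x • f x ∂halfLine with hc
  have hli : LocallyIntegrable (fun _ : ℝ => c) halfLine := locallyIntegrable_const c
  have key : (fun x => f x - c) =ᵐ[halfLine] 0 := by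
    refine ae_zero_of_test (hf.sub hli) fun η hη => ?_
    have hint : ∀ {η : ℝ → ℝ}, IsTest η → Integrable η halfLine := fun hη =>
      (hη.1.continuous.integrable_of_hasCompactSupport hη.2.1).integrableOn
    set m := ∫ x, η x ∂halfLine with hm
    have htest : IsTest (fun x => η x - m * ρ x) := by
      refine ⟨hη.1.sub (contDiff_const.mul hρ.1), hη.2.1.sub hρ.2.1.mul_left, ?_⟩
      intro x hx
      have h1 : tsupport (fun x => η x - m * ρ x) ⊆ tsupport η ∪ tsupport ρ := by
        refine closure_minimal (fun y hy => ?_)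
          ((isClosed_tsupport _).union (isClosed_tsupport _))
        by_contra hcon
        rw [mem_union, not_or] at hcon
        apply hy
        simp [image_eq_zero_of_notMem_tsupport hcon.1, image_eq_zero_of_notMem_tsupport hcon.2]
      rcases h1 hx with h2 | h2
      exacts [hη.2.2 h2, hρ.2.2 h2]
    have hm0 : ∫ x, (η x - m * ρ x) ∂halfLine = 0 := by
      rw [integral_sub (hint hη) ((hint hρ).const_mul m), integral_const_mul, hρ1, ← hm]
      ring
    obtain ⟨ζ, hζ, hζ'⟩ := exists_primitive htest hm0
    have h1 := h ζ hζ
    rw [hζ'] at h1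
    have e1 : ∫ x, (η x - m * ρ x) • f x ∂halfLine
        = ∫ x, η x • f x ∂halfLine - (m : ℂ) * c := by
      rw [hc, ← integral_const_mul, ← integral_sub (integrable_test hη hf)
        ((integrable_test hρ hf).const_mul _)]
      congr 1; ext x; simp [sub_mul, mul_assoc]
    have e2 : ∫ x, η x • (f x - c) ∂halfLine = ∫ x, η x • f x ∂halfLine - (m : ℂ) * c := by
      simp only [smul_sub]
      rw [integral_sub (integrable_test hη hf) (integrable_test hη hli), integral_smul_const,
        ← hm]
      simp
    rw [e2, ← e1]; exact h1
  filter_upwards [key] with x hx using sub_eq_zero.1 hx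

/-- The primitive, vanishing at `0`, of a function on the half-line. -/
def primitive (g : ℝ → ℂ) (x : ℝ) : ℂ := ∫ t in (0 : ℝ)..x, g t ∂halfLine

theorem continuous_primitive {g : ℝ → ℂ} (hg : LocallyIntegrable g halfLine) :
    Continuous (primitive g) :=
  intervalIntegral.continuous_primitive
    (fun _ _ => (hg.integrableOn_isCompact isCompact_uIcc).intervalIntegrable) 0

theorem primitive_eq {g : ℝ → ℂ} {x : ℝ} (hx : 0 < x) :
    primitive g x = ∫ t, (Iic x).indicator g t ∂halfLine := by
  rw [primitive, intervalIntegral.integral_of_le hx.le, integral_indicator measurableSet_Iic,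
    Measure.restrict_restrict measurableSet_Ioc, Measure.restrict_restrict measurableSet_Iic]
  congr 2
  ext t; simp only [mem_inter_iff, mem_Ioc, mem_Ioi, mem_Iic]; tauto

theorem isWeakDeriv_primitive {g : ℝ → ℂ} (hg : LocallyIntegrable g halfLine) :
    IsWeakDeriv (primitive g) g := by
  intro η hη
  obtain ⟨M, hM⟩ : ∃ M : ℝ, ∀ x, M < x → deriv η x = 0 := by
    obtain ⟨M, hM⟩ := (hη.2.1.deriv : IsCompact (tsupport (deriv η))).bddAbove
    exact ⟨M, fun x hx => image_eq_zero_of_notMem_tsupport fun h => not_le.2 hx (hM h)⟩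
  have hgM : Integrable ((Icc 0 M).indicator g) halfLine :=
    (integrable_indicator_iff measurableSet_Icc).2 (hg.integrableOn_isCompact isCompact_Icc)
  have hη' : Integrable (deriv η) halfLine :=
    ((hη.1.continuous_deriv (by simp)).integrable_of_hasCompactSupport hη.2.1.deriv).integrableOn
  let K : ℝ → ℝ → ℂ := fun x t =>
    {p : ℝ × ℝ | p.2 ≤ p.1}.indicator (fun p => deriv η p.1 • (Icc 0 M).indicator g p.2) (x, t)
  have hK : Integrable (Function.uncurry K) (halfLine.prod halfLine) :=
    (hη'.smul_prod hgM).indicator (measurableSet_le measurable_snd measurable_fst)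
  have hswap := integral_integral_swap hK
  have e1 : ∫ x, deriv η x • primitive g x ∂halfLine = ∫ x, ∫ t, K x t ∂halfLine ∂halfLine := by
    refine setIntegral_congr_fun measurableSet_Ioi fun x hx => ?_
    show _ = _
    rw [primitive_eq hx, ← integral_smul]
    refine setIntegral_congr_fun measurableSet_Ioi fun t ht => ?_
    simp only [K, indicator_apply, mem_ofPred_eq, mem_Iic, mem_Icc]
    by_cases htx : t ≤ x
    · by_cases hxM : M < x
      · simp [hM x hxM]
      · have : t ≤ M := htx.trans (not_lt.1 hxM)
        simp [htx, this, (mem_Ioi.1 ht).le]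
    · simp [htx]
  have e2 : ∫ t, ∫ x, K x t ∂halfLine ∂halfLine = ∫ t, -(η t • g t) ∂halfLine := by
    refine setIntegral_congr_fun measurableSet_Ioi fun t ht => ?_
    show _ = _
    have h1 : ∀ x, K x t = (Ici t).indicator (deriv η) x • (Icc 0 M).indicator g t := by
      intro x
      simp only [K, indicator_apply, mem_ofPred_eq, mem_Ici]
      split_ifs <;> simp
    simp only [h1]
    rw [integral_smul_const, integral_indicator measurableSet_Ici,
      Measure.restrict_restrict measurableSet_Ici,
      (inter_eq_left.2 (fun x hx => lt_of_lt_of_le (mem_Ioi.1 ht) (mem_Ici.1 hx)) :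
        Ici t ∩ Ioi 0 = Ici t), integral_Ici_eq_integral_Ioi,
      hη.2.1.integral_Ioi_deriv_eq (hη.1.of_le (by simp)) t]
    by_cases htM : t ≤ M
    · simp [htM, (mem_Ioi.1 ht).le]
    · have : η t = 0 := by
        have h2 := hη.2.1.integral_Ioi_deriv_eq (hη.1.of_le (by simp)) t
        rw [setIntegral_eq_zero_of_forall_eq_zero
          (t := Ioi t) (fun x hx => hM x ((not_le.1 htM).trans (mem_Ioi.1 hx)))] at h2
        simpa using h2.symm
      simp [this]
  rw [e1, hswap, e2, integral_neg]

/-- A function with a weak derivative is, up to a null set, a constant plus the primitive of its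
weak derivative. -/
theorem IsWeakDeriv.exists_const {f g : ℝ → ℂ} (hf : LocallyIntegrable f halfLine)
    (hg : LocallyIntegrable g halfLine) (h : IsWeakDeriv f g) :
    ∃ c : ℂ, f =ᵐ[halfLine] fun x => c + primitive g x := by
  have hp : LocallyIntegrable (primitive g) halfLine := (continuous_primitive hg).locallyIntegrable
  obtain ⟨c, hc⟩ := ae_const_of_weakDeriv_zero (hf.sub hp) (fun η hη => by
    simp only [Pi.sub_apply, smul_sub]
    rw [integral_sub (integrable_deriv_test hη hf) (integrable_deriv_test hη hp), h η hη,
      isWeakDeriv_primitive hg η hη, sub_self])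
  refine ⟨c, ?_⟩
  filter_upwards [hc] with x hx
  rw [← hx]; simp

theorem IsWeakDeriv.unique {f g g' : ℝ → ℂ} (hg : LocallyIntegrable g halfLine)
    (hg' : LocallyIntegrable g' halfLine) (h : IsWeakDeriv f g) (h' : IsWeakDeriv f g') :
    g =ᵐ[halfLine] g' := by
  have := ae_zero_of_test (hg.sub hg') (fun η hη => by
    simp only [Pi.sub_apply, smul_sub]
    rw [integral_sub (integrable_test hη hg) (integrable_test hη hg'),
      ← neg_eq_iff_eq_neg.2 (h η hη), ← neg_eq_iff_eq_neg.2 (h' η hη), sub_self])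
  filter_upwards [this] with x hx using sub_eq_zero.1 hx

/-- `f(0+) = a`: `f` agrees almost everywhere on `(0, ∞)` with a function that is continuous on
`[0, ∞)` and takes the value `a` at `0`. -/
def HasTrace (f : ℝ → ℂ) (a : ℂ) : Prop :=
  ∃ F : ℝ → ℂ, ContinuousOn F (Ici 0) ∧ f =ᵐ[halfLine] F ∧ F 0 = a

theorem HasTrace.unique {f : ℝ → ℂ} {a b : ℂ} (ha : HasTrace f a) (hb : HasTrace f b) :
    a = b := by
  obtain ⟨F, hF, hfF, rfl⟩ := ha
  obtain ⟨G, hG, hfG, rfl⟩ := hb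
  have hFG : F =ᵐ[volume.restrict (Ici (0 : ℝ))] G := by
    rw [Measure.restrict_congr_set Ioi_ae_eq_Ici.symm]
    exact hfF.symm.trans hfG
  exact Measure.eqOn_of_ae_eq hFG hF hG (by simp) (mem_Ici.2 le_rfl)

theorem IsWeakDeriv.exists_hasTrace {f g : ℝ → ℂ} (hf : LocallyIntegrable f halfLine)
    (hg : LocallyIntegrable g halfLine) (h : IsWeakDeriv f g) : ∃ a, HasTrace f a := by
  obtain ⟨c, hc⟩ := h.exists_const hf hg
  exact ⟨_, _, (continuous_const.add (continuous_primitive hg)).continuousOn, hc, rfl⟩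

/-! ### Sobolev spaces on the half-line -/

theorem L2.locInt (f : L2) : LocallyIntegrable f halfLine := locInt_of_memLp (Lp.memLp f)

theorem IsWeakDeriv.congr {f f' g g' : ℝ → ℂ} (h : IsWeakDeriv f g) (hf : f' =ᵐ[halfLine] f)
    (hg : g' =ᵐ[halfLine] g) : IsWeakDeriv f' g' := by
  intro η hη
  have e1 : ∫ x, deriv η x • f' x ∂halfLine = ∫ x, deriv η x • f x ∂halfLine :=
    integral_congr_ae (by filter_upwards [hf] with x hx; rw [hx])
  have e2 : ∫ x, η x • g' x ∂halfLine = ∫ x, η x • g x ∂halfLine :=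
    integral_congr_ae (by filter_upwards [hg] with x hx; rw [hx])
  rw [e1, e2, h η hη]

theorem isWeakDeriv_zero : IsWeakDeriv (⇑(0 : L2)) (⇑(0 : L2)) := by
  have h : IsWeakDeriv (0 : ℝ → ℂ) 0 := fun η _ => by simp
  exact h.congr (Lp.coeFn_zero ..) (Lp.coeFn_zero ..)

theorem isWeakDeriv_add {f f' g g' : L2} (h : IsWeakDeriv f g) (h' : IsWeakDeriv f' g') :
    IsWeakDeriv (⇑(f + f')) (⇑(g + g')) := by
  have : IsWeakDeriv (⇑f + ⇑f') (⇑g + ⇑g') := fun η hη => by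
    simp only [Pi.add_apply, smul_add]
    rw [integral_add (integrable_deriv_test hη f.locInt) (integrable_deriv_test hη f'.locInt),
      integral_add (integrable_test hη g.locInt) (integrable_test hη g'.locInt), h η hη, h' η hη]
    ring
  exact this.congr (Lp.coeFn_add ..) (Lp.coeFn_add ..)

theorem isWeakDeriv_smul (c : ℂ) {f g : L2} (h : IsWeakDeriv f g) :
    IsWeakDeriv (⇑(c • f)) (⇑(c • g)) := by
  have : IsWeakDeriv (c • ⇑f) (c • ⇑g) := fun η hη => by
    simp only [Pi.smul_apply, smul_comm _ c, integral_smul]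
    rw [h η hη, smul_neg]
  exact this.congr (Lp.coeFn_smul ..) (Lp.coeFn_smul ..)

/-- The Sobolev space `H¹(ℝ₊)`: square integrable functions with square integrable weak
derivative. -/
def H1 : Submodule ℂ L2 where
  carrier := {f | ∃ g : L2, IsWeakDeriv f g}
  zero_mem' := ⟨0, isWeakDeriv_zero⟩
  add_mem' := fun ⟨g, hg⟩ ⟨g', hg'⟩ => ⟨g + g', isWeakDeriv_add hg hg'⟩
  smul_mem' := fun c _ ⟨g, hg⟩ => ⟨c • g, isWeakDeriv_smul c hg⟩

theorem L2.weakDeriv_unique {f g g' : L2} (h : IsWeakDeriv f g) (h' : IsWeakDeriv f g') :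
    g = g' := Lp.ext (h.unique g.locInt g'.locInt h')

/-- The weak derivative `φ ↦ φ'` from `H¹(ℝ₊)` to `L²(ℝ₊)`. -/
def deriv1 : H1 →ₗ[ℂ] L2 where
  toFun f := f.2.choose
  map_add' f g := L2.weakDeriv_unique (f + g).2.choose_spec
    (isWeakDeriv_add f.2.choose_spec g.2.choose_spec)
  map_smul' c f := L2.weakDeriv_unique (c • f).2.choose_spec (isWeakDeriv_smul c f.2.choose_spec)

theorem isWeakDeriv_deriv1 (f : H1) : IsWeakDeriv (⇑(f : L2)) (⇑(deriv1 f)) := f.2.choose_spec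

theorem exists_hasTrace (f : H1) : ∃ a, HasTrace (⇑(f : L2)) a :=
  (isWeakDeriv_deriv1 f).exists_hasTrace (L2.locInt _) (L2.locInt _)

/-- The boundary value `φ ↦ φ(0+)` on `H¹(ℝ₊)`. -/
def trace : H1 →ₗ[ℂ] ℂ where
  toFun f := (exists_hasTrace f).choose
  map_add' f g := by
    refine (exists_hasTrace (f + g)).choose_spec.unique ?_
    obtain ⟨F, hF, hfF, hF0⟩ := (exists_hasTrace f).choose_spec
    obtain ⟨G, hG, hgG, hG0⟩ := (exists_hasTrace g).choose_spec
    exact ⟨F + G, hF.add hG, (Lp.coeFn_add ..).trans (hfF.add hgG), by simp [hF0, hG0]⟩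
  map_smul' c f := by
    refine (exists_hasTrace (c • f)).choose_spec.unique ?_
    obtain ⟨F, hF, hfF, hF0⟩ := (exists_hasTrace f).choose_spec
    exact ⟨c • F, hF.const_smul c, (Lp.coeFn_smul ..).trans (hfF.const_smul c), by simp [hF0]⟩

theorem hasTrace_trace (f : H1) : HasTrace (⇑(f : L2)) (trace f) :=
  (exists_hasTrace f).choose_spec

/-- The Sobolev space `H²(ℝ₊)`: the `φ ∈ H¹(ℝ₊)` with `φ' ∈ H¹(ℝ₊)`. -/
def H2 : Submodule ℂ L2 := (H1.comap deriv1).map H1.subtype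

theorem mem_H2 {f : L2} : f ∈ H2 ↔ ∃ h : f ∈ H1, deriv1 ⟨f, h⟩ ∈ H1 := by
  simp [H2, Submodule.mem_map]

/-- The inclusion of `H²(ℝ₊)` into `H¹(ℝ₊)`. -/
def incl : H2 →ₗ[ℂ] H1 :=
  Submodule.inclusion fun _ h => (mem_H2.1 h).1

/-- The first derivative `φ ↦ φ'` from `H²(ℝ₊)` to `H¹(ℝ₊)`. -/
def derivH2 : H2 →ₗ[ℂ] H1 :=
  (deriv1.comp incl).codRestrict H1 fun f => (mem_H2.1 f.2).2

/-- The second derivative `φ ↦ φ''` from `H²(ℝ₊)` to `L²(ℝ₊)`. -/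
def deriv2 : H2 →ₗ[ℂ] L2 := deriv1.comp derivH2

/-! ### Resolvents of unbounded operators -/

section Resolvent

variable {E : Type*} [NormedAddCommGroup E] [InnerProductSpace ℂ E]

/-- `R` is the bounded, everywhere defined, two-sided inverse `(-T + z)⁻¹`. -/
def IsResolventAt (T : E →ₗ.[ℂ] E) (z : ℂ) (R : E →L[ℂ] E) : Prop :=
  (∀ v : E, ∃ h : R v ∈ T.domain, -T ⟨R v, h⟩ + z • R v = v) ∧
    ∀ u : T.domain, R (-T u + z • (u : E)) = u

/-- The resolvent set `ρ(T)`. -/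
def resolventSet (T : E →ₗ.[ℂ] E) : Set ℂ := {z | ∃ R : E →L[ℂ] E, IsResolventAt T z R}

open Classical in
/-- The resolvent `(-T + z)⁻¹`, for `z ∈ ρ(T)`; by convention `0` for other `z`. -/
def resolventOp (T : E →ₗ.[ℂ] E) (z : ℂ) : E →L[ℂ] E :=
  if h : ∃ R : E →L[ℂ] E, IsResolventAt T z R then h.choose else 0

theorem IsResolventAt.unique {T : E →ₗ.[ℂ] E} {z : ℂ} {R R' : E →L[ℂ] E}
    (h : IsResolventAt T z R) (h' : IsResolventAt T z R') : R = R' := by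
  ext v
  obtain ⟨hv, e⟩ := h.1 v
  have := h'.2 ⟨R v, hv⟩
  rw [e] at this
  exact this.symm

theorem isResolventAt_resolventOp {T : E →ₗ.[ℂ] E} {z : ℂ} (hz : z ∈ resolventSet T) :
    IsResolventAt T z (resolventOp T z) := by
  have h : ∃ R : E →L[ℂ] E, IsResolventAt T z R := hz
  rw [resolventOp, dif_pos h]
  exact h.choose_spec

end Resolvent

/-! ### The generalized Lamb model -/

section Model

variable {𝔥 : Type*} [NormedAddCommGroup 𝔥] [InnerProductSpace ℂ 𝔥]

/-- The Hilbert space direct sum `L²(ℝ₊) ⊕ 𝔥`. -/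
abbrev Space (𝔥 : Type*) [NormedAddCommGroup 𝔥] [InnerProductSpace ℂ 𝔥] : Type _ :=
  WithLp 2 (L2 × 𝔥)

/-- The decoupled operator `A₀(φ, y) = (φ'', L y)` with domain
`{(φ, y) ∈ H²(ℝ₊) ⊕ 𝔥 : φ'(0+) = 0}`. -/
def A₀ (L : 𝔥 →ₗ[ℂ] 𝔥) : Space 𝔥 →ₗ.[ℂ] Space 𝔥 where
  domain :=
    { carrier := {u | ∃ h : u.fst ∈ H2, trace (derivH2 ⟨u.fst, h⟩) = 0}
      zero_mem' := ⟨H2.zero_mem, map_zero (trace ∘ₗ derivH2)⟩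
      add_mem' := fun {u v} ⟨h, e⟩ ⟨h', e'⟩ => ⟨H2.add_mem h h',
        ((trace ∘ₗ derivH2).map_add ⟨u.fst, h⟩ ⟨v.fst, h'⟩).trans (by simp [e, e'])⟩
      smul_mem' := fun c u ⟨h, e⟩ => ⟨H2.smul_mem c h,
        ((trace ∘ₗ derivH2).map_smul c ⟨u.fst, h⟩).trans (by simp [e])⟩ }
  toFun :=
    { toFun := fun u => WithLp.toLp 2 (deriv2 ⟨u.1.fst, u.2.1⟩, L u.1.snd)
      map_add' := fun u v => by
        have h := deriv2.map_add ⟨u.1.fst, u.2.1⟩ ⟨v.1.fst, v.2.1⟩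
        refine (WithLp.equiv 2 _).injective (Prod.ext h ?_)
        simp
      map_smul' := fun c u => by
        have h := deriv2.map_smul c ⟨u.1.fst, u.2.1⟩
        refine (WithLp.equiv 2 _).injective (Prod.ext h ?_)
        simp }

/-- The coupling functional `τ(φ, y) = φ(0+) - ⟨w, y⟩` on `H¹(ℝ₊) ⊕ 𝔥`. -/
def τ (w : 𝔥) : H1 × 𝔥 →ₗ[ℂ] ℂ :=
  trace ∘ₗ LinearMap.fst ℂ H1 𝔥 - (innerₛₗ ℂ w) ∘ₗ LinearMap.snd ℂ H1 𝔥

/-- The kernel of `τ`, as a subspace of `L²(ℝ₊) ⊕ 𝔥`. -/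
def kerτ (w : 𝔥) : Submodule ℂ (Space 𝔥) where
  carrier := {u | ∃ h : u.fst ∈ H1, τ w (⟨u.fst, h⟩, u.snd) = 0}
  zero_mem' := ⟨H1.zero_mem, map_zero (τ w)⟩
  add_mem' := fun {u v} ⟨h, e⟩ ⟨h', e'⟩ => ⟨H1.add_mem h h',
    ((τ w).map_add (⟨u.fst, h⟩, u.snd) (⟨v.fst, h'⟩, v.snd)).trans (by simp [e, e'])⟩
  smul_mem' := fun c u ⟨h, e⟩ => ⟨H1.smul_mem c h,
    ((τ w).map_smul c (⟨u.fst, h⟩, u.snd)).trans (by simp [e])⟩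

/-- The restriction of `A₀` to the kernel of `τ`. -/
def A₀dot (L : 𝔥 →ₗ[ℂ] 𝔥) (w : 𝔥) : Space 𝔥 →ₗ.[ℂ] Space 𝔥 := (A₀ L).domRestrict (kerτ w)

/-- The boundary functional `(φ, y) ↦ θ φ'(0+) + φ(0+) - ⟨w, y⟩` on `H²(ℝ₊) ⊕ 𝔥`. -/
def boundary (w : 𝔥) (θ : ℝ) : H2 × 𝔥 →ₗ[ℂ] ℂ :=
  ((θ : ℂ) • (trace ∘ₗ derivH2) + trace ∘ₗ incl) ∘ₗ LinearMap.fst ℂ H2 𝔥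
    - (innerₛₗ ℂ w) ∘ₗ LinearMap.snd ℂ H2 𝔥

theorem boundary_eq_zero_iff (w : 𝔥) (θ : ℝ) (φ : H2) (y : 𝔥) : boundary w θ (φ, y) = 0 ↔
    θ * trace (derivH2 φ) + trace (incl φ) = inner ℂ w y := by
  simp [boundary, sub_eq_zero]

/-- The coupled operator `A(φ, y) = (φ'', L y + φ'(0+) w)` with domain
`{(φ, y) ∈ H²(ℝ₊) ⊕ 𝔥 : θ φ'(0+) + φ(0+) = ⟨w, y⟩}`. -/
def A (L : 𝔥 →ₗ[ℂ] 𝔥) (w : 𝔥) (θ : ℝ) : Space 𝔥 →ₗ.[ℂ] Space 𝔥 where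
  domain :=
    { carrier := {u | ∃ h : u.fst ∈ H2,
        θ * trace (derivH2 ⟨u.fst, h⟩) + trace (incl ⟨u.fst, h⟩) = inner ℂ w u.snd}
      zero_mem' := ⟨H2.zero_mem, (boundary_eq_zero_iff ..).1 (map_zero (boundary w θ))⟩
      add_mem' := fun {u v} ⟨h, e⟩ ⟨h', e'⟩ => ⟨H2.add_mem h h',
        (boundary_eq_zero_iff ..).1 (((boundary w θ).map_add (⟨u.fst, h⟩, u.snd)
          (⟨v.fst, h'⟩, v.snd)).trans (by
            rw [(boundary_eq_zero_iff ..).2 e, (boundary_eq_zero_iff ..).2 e', add_zero]))⟩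
      smul_mem' := fun c u ⟨h, e⟩ => ⟨H2.smul_mem c h,
        (boundary_eq_zero_iff ..).1 (((boundary w θ).map_smul c (⟨u.fst, h⟩, u.snd)).trans (by
            rw [(boundary_eq_zero_iff ..).2 e, smul_zero]))⟩ }
  toFun :=
    { toFun := fun u => WithLp.toLp 2
        (deriv2 ⟨u.1.fst, u.2.1⟩, L u.1.snd + trace (derivH2 ⟨u.1.fst, u.2.1⟩) • w)
      map_add' := fun u v => by
        have h := deriv2.map_add ⟨u.1.fst, u.2.1⟩ ⟨v.1.fst, v.2.1⟩
        have h' := (trace ∘ₗ derivH2).map_add ⟨u.1.fst, u.2.1⟩ ⟨v.1.fst, v.2.1⟩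
        refine (WithLp.equiv 2 _).injective (Prod.ext h ?_)
        refine (congrArg (fun a : ℂ => L (u.1.snd + v.1.snd) + a • w) h').trans ?_
        simp [add_smul]
        abel
      map_smul' := fun c u => by
        have h := deriv2.map_smul c ⟨u.1.fst, u.2.1⟩
        have h' := (trace ∘ₗ derivH2).map_smul c ⟨u.1.fst, u.2.1⟩
        refine (WithLp.equiv 2 _).injective (Prod.ext h ?_)
        refine (congrArg (fun a : ℂ => L (c • u.1.snd) + a • w) h').trans ?_
        simp [mul_smul] }

/-- The square root of `z` with positive real part, for `z ∉ (-∞, 0]`; this is `√z` or `-√z`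
according to the sign of `Re √z`, whichever branch of the root `√z` denotes. -/
def sqrtPos (z : ℂ) : ℂ := z ^ (1 / 2 : ℂ)

theorem sqrtPos_sq (z : ℂ) : sqrtPos z ^ 2 = z := by
  have := Complex.cpow_nat_inv_pow z (n := 2) two_ne_zero
  rw [sqrtPos, one_div]
  exact_mod_cast this

theorem sqrtPos_re_pos {z : ℂ} (hz : z ∈ Complex.slitPlane) : 0 < (sqrtPos z).re := by
  have hz0 : z ≠ 0 := Complex.slitPlane_ne_zero hz
  have h := Complex.mem_slitPlane_iff_arg.1 hz
  have him : (Complex.log z * (1 / 2 : ℂ)).im = z.arg / 2 := by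
    rw [show (1 / 2 : ℂ) = ((1 / 2 : ℝ) : ℂ) by norm_num, Complex.im_mul_ofReal,
      Complex.log_im]
    ring
  rw [sqrtPos, Complex.cpow_def_of_ne_zero hz0, Complex.exp_re, him]
  refine mul_pos (Real.exp_pos _) (Real.cos_pos_of_mem_Ioo ⟨?_, ?_⟩)
  · linarith [Complex.neg_pi_lt_arg z]
  · have := lt_of_le_of_ne (Complex.arg_le_pi z) h.1
    linarith

theorem eq_sqrtPos {z s : ℂ} (hs : s ^ 2 = z) (hs0 : 0 < s.re) : s = sqrtPos z := by
  have hz : z ∈ Complex.slitPlane := by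
    rw [Complex.mem_slitPlane_iff, ← hs]
    by_cases him : s.im = 0
    · left; simp [pow_two, him, mul_pos hs0 hs0]
    · right; simp only [pow_two, Complex.mul_im]; intro h; apply him; nlinarith
  have h : s ^ 2 = sqrtPos z ^ 2 := by rw [hs, sqrtPos_sq]
  rcases sq_eq_sq_iff_eq_or_eq_neg.1 h with h | h
  · exact h
  · have := sqrtPos_re_pos hz
    rw [h, Complex.neg_re] at hs0
    linarith

theorem memLp_exp {s : ℂ} (hs : 0 < s.re) :
    MemLp (fun x : ℝ => Complex.exp (-s * x) / s) 2 halfLine := by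
  have hc : Continuous fun x : ℝ => Complex.exp (-s * x) / s := by fun_prop
  rw [memLp_two_iff_integrable_sq_norm hc.aestronglyMeasurable]
  have h := (integrableOn_exp_mul_Ioi (a := -(2 * s.re)) (by linarith) 0).const_mul (‖s‖⁻¹ ^ 2)
  refine h.congr (Filter.Eventually.of_forall fun x => ?_)
  simp only [norm_div, Complex.norm_exp, div_pow, ← Real.exp_nat_mul]
  simp
  ring_nf

/-- The function `x ↦ e^{-√z x} / √z` in `L²(ℝ₊)`, where `Re √z > 0`. -/
def expL2 {z : ℂ} (hz : z ∈ Complex.slitPlane) : L2 := (memLp_exp (sqrtPos_re_pos hz)).toLp _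

/-- `G_z = (e^{-√z x} / √z, -(-L + z)⁻¹ w)`, where `Re √z > 0`. -/
def G (L : 𝔥 →ₗ[ℂ] 𝔥) (w : 𝔥) {z : ℂ} (hz : z ∈ Complex.slitPlane) : Space 𝔥 :=
  WithLp.toLp 2 (expL2 hz, -(resolvent L z w))

/-- `Γ(z) = -(1 / √z + ⟨w, (-L + z)⁻¹ w⟩)`, where `Re √z > 0`. -/
def Γ (L : 𝔥 →ₗ[ℂ] 𝔥) (w : 𝔥) (z : ℂ) : ℂ := -(1 / sqrtPos z + inner ℂ w (resolvent L z w))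

theorem conj_mem {z : ℂ} (hz : z ∈ Complex.slitPlane) : conj z ∈ Complex.slitPlane := by
  simpa [Complex.mem_slitPlane_iff] using hz

end Model

end
end GeneralizedLamb

/-!
# Self-adjointness and Krein's formula for the generalized Lamb model

Everything rests on integration by parts on the half-line (`inner_deriv1_add`), in the form
`⟨u, v'⟩ + ⟨u', v⟩ = -conj u(0+) · v(0+)` for `u, v ∈ H¹(ℝ₊)`. Since elements of `H¹` are constants
plus primitives of `L²` functions, it follows from Fubini's theorem for products of primitives, the
contribution of infinity being zero because an integrable function can only converge to `0`.

The Neumann resolvent `(-D² + z)⁻¹` on `L²(ℝ₊)` comes from the Lax–Milgram theorem: with `s = √z`,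
the form `conj s (⟨ψ', φ'⟩ + s² ⟨ψ, φ⟩)` is coercive on `H¹(ℝ₊)` because `Re s > 0`. Testing the
weak equation against test functions gives `φ ∈ H²`, and testing it against `e^{-s x}` gives
`φ'(0+) = 0` (`exists_neumann`). Integrating `-φ'' + z φ` against the exponential recovers the
boundary values of `φ` (`inner_expL2_conj`); for the decoupled operator this says
`τ ((-A₀ + z)⁻¹ v) = ⟨G_{z*}, v⟩`.

The equation `(-A + z) u = v` then forces `u = (-A₀ + z)⁻¹ v + c G_z` with `c = -φ'(0+)`, and the
boundary condition becomes `(θ + Γ(z)) c = ⟨G_{z*}, v⟩`. If `θ + Γ(z) ≠ 0` this determines `c` and is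
Krein's formula (`isResolventAt_A`); if `θ + Γ(z) = 0`, the vector `G_z` is an eigenvector of `A`
(`G_mem_eigenspace`) and `z ∉ ρ(A)`.

The operator `A` is symmetric (`isFormalAdjoint_A`), so it has no nonreal eigenvalue, hence
`θ + Γ(±i) ≠ 0` and `-A ± i` is surjective. A symmetric operator with this property is self-adjoint
(`isSelfAdjoint_of_surjective`).
-/

namespace GeneralizedLamb
noncomputable section

/-! ### Integration by parts for weakly differentiable functions -/

theorem primitive_eq_setIntegral (g : ℝ → ℂ) {X : ℝ} (hX : 0 ≤ X) :
    primitive g X = ∫ t in Ioc 0 X, g t := by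
  rw [primitive, intervalIntegral.integral_of_le hX, Measure.restrict_restrict measurableSet_Ioc,
    inter_eq_left.2 Ioc_subset_Ioi_self]

theorem integrableOn_Ioc_of_locallyIntegrable {g : ℝ → ℂ} (hg : LocallyIntegrable g halfLine)
    (X : ℝ) : IntegrableOn g (Ioc 0 X) := by
  have h := (hg.integrableOn_isCompact (isCompact_Icc (a := 0) (b := X))).mono_set
    Ioc_subset_Icc_self
  rwa [IntegrableOn, Measure.restrict_restrict measurableSet_Ioc,
    inter_eq_left.2 Ioc_subset_Ioi_self] at h

/-- The product rule for primitives, in integrated form: split the integral of `g(s) h(t)` over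
the square `(0, X]²` along the diagonal. -/
theorem primitive_mul_primitive {g h : ℝ → ℂ} (hg : LocallyIntegrable g halfLine)
    (hh : LocallyIntegrable h halfLine) {X : ℝ} (hX : 0 ≤ X) :
    primitive g X * primitive h X =
      ∫ t in Ioc 0 X, (primitive g t * h t + g t * primitive h t) := by
  have hgX := integrableOn_Ioc_of_locallyIntegrable hg X
  have hhX := integrableOn_Ioc_of_locallyIntegrable hh X
  have hG : ∀ {k : ℝ → ℂ}, ∀ t ∈ Ioc 0 X,
      primitive k t = ∫ s in Ioc 0 X, (Iic t).indicator k s := by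
    intro k t ht
    rw [primitive_eq_setIntegral k ht.1.le, integral_indicator measurableSet_Iic,
      Measure.restrict_restrict measurableSet_Iic]
    congr 2
    ext s; simp only [mem_inter_iff, mem_Ioc, mem_Iic]
    exact ⟨fun hs => ⟨hs.2, hs.1, hs.2.trans ht.2⟩, fun hs => ⟨hs.2.1, hs.1⟩⟩
  have hprod : ∀ {k l : ℝ → ℂ}, LocallyIntegrable k halfLine → IntegrableOn l (Ioc 0 X) →
      IntegrableOn (fun t => primitive k t * l t) (Ioc 0 X) := by
    intro k l hk hl
    have h1 := hl.mul_continuousOn_of_subset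
      (continuous_primitive hk).continuousOn measurableSet_Ioc isCompact_Icc Ioc_subset_Icc_self
    simpa only [mul_comm] using h1
  -- Fubini on the part `t < s` of the square.
  let K : ℝ → ℝ → ℂ := fun t s =>
    {p : ℝ × ℝ | p.1 < p.2}.indicator (fun p => h p.1 * g p.2) (t, s)
  have hK : Integrable (Function.uncurry K)
      ((volume.restrict (Ioc 0 X)).prod (volume.restrict (Ioc 0 X))) :=
    (hhX.integrable.mul_prod hgX.integrable).indicator
      (measurableSet_lt measurable_fst measurable_snd)
  have hswap := integral_integral_swap hK
  have e1 : ∫ t in Ioc 0 X, ∫ s in Ioc 0 X, K t s =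
      primitive g X * primitive h X - ∫ t in Ioc 0 X, primitive g t * h t := by
    rw [primitive_eq_setIntegral h hX, ← integral_const_mul,
      ← integral_sub (hhX.integrable.const_mul _) (hprod hg hhX)]
    refine setIntegral_congr_fun measurableSet_Ioc fun t ht => ?_
    rw [hG t ht, primitive_eq_setIntegral g hX, ← sub_mul, ← integral_sub hgX
      (hgX.integrable.indicator measurableSet_Iic), ← integral_mul_const]
    refine integral_congr_ae (Filter.Eventually.of_forall fun s => ?_)
    simp only [K, indicator_apply, mem_ofPred_eq, mem_Iic]
    by_cases hst : s ≤ t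
    · simp [hst]
    · simp [hst, not_le.1 hst, mul_comm]
  have e2 : ∫ s in Ioc 0 X, ∫ t in Ioc 0 X, K t s = ∫ s in Ioc 0 X, g s * primitive h s := by
    refine setIntegral_congr_fun measurableSet_Ioc fun s hs => ?_
    rw [hG s hs, ← integral_const_mul]
    have hne : ∀ᵐ t ∂(volume.restrict (Ioc 0 X)), t ≠ s :=
      ae_restrict_of_ae (by simp [ae_iff])
    refine integral_congr_ae ?_
    filter_upwards [hne] with t ht
    simp only [K, indicator_apply, mem_ofPred_eq, mem_Iic]
    by_cases hst : t < s
    · simp [hst, hst.le, mul_comm]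
    · have : ¬ t ≤ s := fun h => hst (lt_of_le_of_ne h ht)
      simp [hst, this]
  have hgh : IntegrableOn (fun t => g t * primitive h t) (Ioc 0 X) := by
    simpa only [mul_comm] using hprod hh hgX
  rw [integral_add (hprod hg hhX) hgh, ← e2, ← hswap, e1]
  ring

/-- Integration by parts on the half-line; the boundary term at infinity vanishes because the
product `f g` is integrable and has a limit. -/
theorem integral_weakDeriv_mul {f f' g g' : ℝ → ℂ} {a b : ℂ} (hf : MemLp f 2 halfLine)
    (hf' : MemLp f' 2 halfLine) (hg : MemLp g 2 halfLine) (hg' : MemLp g' 2 halfLine)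
    (hff' : IsWeakDeriv f f') (hgg' : IsWeakDeriv g g') (ha : HasTrace f a) (hb : HasTrace g b) :
    ∫ x, (f x * g' x + f' x * g x) ∂halfLine = -(a * b) := by
  have lf' := locInt_of_memLp hf'
  have lg' := locInt_of_memLp hg'
  have repr : ∀ {k k' : ℝ → ℂ} {c : ℂ}, MemLp k 2 halfLine → LocallyIntegrable k' halfLine →
      IsWeakDeriv k k' → HasTrace k c → k =ᵐ[halfLine] fun x => c + primitive k' x := by
    intro k k' c hk hk' h hc
    obtain ⟨d, hd⟩ := h.exists_const (locInt_of_memLp hk) hk'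
    have : HasTrace k d :=
      ⟨_, (continuous_const.add (continuous_primitive hk')).continuousOn, hd, by simp [primitive]⟩
    rwa [hc.unique this]
  have hF := repr hf lf' hff' ha
  have hG := repr hg lg' hgg' hb
  have hint : Integrable (fun x => f x * g' x + f' x * g x) halfLine :=
    (hf.integrable_mul hg').add (hf'.integrable_mul hg)
  have hlim := intervalIntegral_tendsto_integral_Ioi (0 : ℝ) (μ := volume)
    (f := fun x => f x * g' x + f' x * g x) hint Filter.tendsto_id
  have hfg : Integrable (fun x => (a + primitive f' x) * (b + primitive g' x)) halfLine := by
    refine (hf.integrable_mul hg).congr ?_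
    filter_upwards [hF, hG] with x h1 h2
    simp [h1, h2]
  have key : ∀ X : ℝ, 0 ≤ X → (a + primitive f' X) * (b + primitive g' X) =
      a * b + ∫ x in (0 : ℝ)..X, (f x * g' x + f' x * g x) := by
    intro X hX
    have i1 := integrableOn_Ioc_of_locallyIntegrable lf' X
    have i2 := integrableOn_Ioc_of_locallyIntegrable lg' X
    have i3 : IntegrableOn (fun t => primitive f' t * g' t + f' t * primitive g' t) (Ioc 0 X) := by
      refine IntegrableOn.add ?_ ?_
      · simpa only [mul_comm] using i2.mul_continuousOn_of_subset
          (continuous_primitive lf').continuousOn measurableSet_Ioc isCompact_Icc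
          Ioc_subset_Icc_self
      · exact i1.mul_continuousOn_of_subset
          (continuous_primitive lg').continuousOn measurableSet_Ioc isCompact_Icc
          Ioc_subset_Icc_self
    rw [intervalIntegral.integral_of_le hX]
    have : ∫ x in Ioc 0 X, (f x * g' x + f' x * g x) = ∫ x in Ioc 0 X,
        ((a * g' x + b * f' x) + (primitive f' x * g' x + f' x * primitive g' x)) := by
      have hsub : volume.restrict (Ioc 0 X) ≤ halfLine :=
        Measure.restrict_mono Ioc_subset_Ioi_self le_rfl
      refine integral_congr_ae ?_
      filter_upwards [Measure.absolutelyContinuous_of_le hsub hF,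
        Measure.absolutelyContinuous_of_le hsub hG] with x h1 h2
      rw [h1, h2]; ring
    have i4 : IntegrableOn (fun t => a * g' t + b * f' t) (Ioc 0 X) :=
      (i2.integrable.const_mul a).add (i1.integrable.const_mul b)
    rw [this, integral_add i4 i3,
      ← primitive_mul_primitive lf' lg' hX,
      integral_add (i2.integrable.const_mul a) (i1.integrable.const_mul b), integral_const_mul,
      integral_const_mul, ← primitive_eq_setIntegral g' hX, ← primitive_eq_setIntegral f' hX]
    ring
  have hlim' : Filter.Tendsto (fun X => (a + primitive f' X) * (b + primitive g' X)) Filter.atTop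
      (nhds (a * b + ∫ x, (f x * g' x + f' x * g x) ∂halfLine)) := by
    refine (hlim.const_add (a * b)).congr' ?_
    filter_upwards [Filter.eventually_ge_atTop 0] with X hX using (key X hX).symm
  have hz := IntegrableAtFilter.eq_zero_of_tendsto (μ := volume) (l := Filter.atTop)
    ⟨Ioi 0, Filter.Ioi_mem_atTop 0, hfg⟩ (fun s hs => by
      obtain ⟨c, hc⟩ := Filter.mem_atTop_sets.1 hs
      exact top_le_iff.1 (by simpa using measure_mono (μ := volume) (show Ici c ⊆ s from hc)))
    hlim'
  linear_combination hz

theorem IsWeakDeriv.conj {f f' : ℝ → ℂ} (h : IsWeakDeriv f f') :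
    IsWeakDeriv (fun x => conj (f x)) fun x => conj (f' x) := by
  intro η hη
  have e : ∀ (r : ℝ) (c : ℂ), r • conj c = conj (r • c) := by intro r c; simp
  simp only [e]
  rw [integral_conj, integral_conj, h η hη, map_neg]

theorem HasTrace.conj {f : ℝ → ℂ} {a : ℂ} (h : HasTrace f a) :
    HasTrace (fun x => conj (f x)) (conj a) := by
  obtain ⟨F, hF, hfF, rfl⟩ := h
  refine ⟨fun x => conj (F x), Complex.continuous_conj.comp_continuousOn hF, ?_, rfl⟩
  filter_upwards [hfF] with x hx
  rw [hx]

/-- Integration by parts on `H¹(ℝ₊)`, with the boundary term at `0`. -/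
theorem inner_deriv1_add (u v : H1) :
    inner ℂ (u : L2) (deriv1 v) + inner ℂ (deriv1 u) (v : L2) = -(conj (trace u) * trace v) := by
  rw [L2.inner_def, L2.inner_def, ← integral_add (L2.integrable_inner _ _)
    (L2.integrable_inner _ _), ← integral_weakDeriv_mul (Lp.memLp (u : L2)).star
    (Lp.memLp (deriv1 u)).star (Lp.memLp (v : L2)) (Lp.memLp (deriv1 v))
    (isWeakDeriv_deriv1 u).conj (isWeakDeriv_deriv1 v) (hasTrace_trace u).conj (hasTrace_trace v)]
  refine integral_congr_ae (Filter.Eventually.of_forall fun x => ?_)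
  simp [mul_comm]

/-! ### Test functions and the closed graph of the weak derivative -/

theorem isWeakDeriv_of_hasDerivAt {f f' : ℝ → ℂ} (hf : ∀ x, HasDerivAt f (f' x) x)
    (hf' : Continuous f') : IsWeakDeriv f f' := by
  intro η hη
  have hfc : Continuous f := continuous_iff_continuousAt.2 fun x => (hf x).continuousAt
  have hηd : ∀ x, HasDerivAt η (deriv η x) x := fun x =>
    (hη.1.differentiable (by simp) x).hasDerivAt
  have hη' : Continuous (deriv η) := hη.1.continuous_deriv (by simp)
  have key := integral_bilinear_hasDerivAt_right_eq_neg_left_of_integrable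
    (L := ContinuousLinearMap.lsmul ℝ ℝ (E := ℂ)) (u := η) (v := f) (u' := deriv η) (v' := f')
    (fun x _ => hηd x) (fun x _ => hf x)
    ((hη.1.continuous.smul hf').integrable_of_hasCompactSupport hη.2.1.smul_right)
    ((hη'.smul hfc).integrable_of_hasCompactSupport hη.2.1.deriv.smul_right)
    ((hη.1.continuous.smul hfc).integrable_of_hasCompactSupport hη.2.1.smul_right)
  simp only [ContinuousLinearMap.lsmul_apply] at key
  rw [setIntegral_eq_integral_of_forall_compl_eq_zero,
    setIntegral_eq_integral_of_forall_compl_eq_zero, key, neg_neg]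
  · intro x hx
    rw [image_eq_zero_of_notMem_tsupport fun h => hx (hη.2.2 h), zero_smul]
  · intro x hx
    rw [image_eq_zero_of_notMem_tsupport fun h => hx (hη.2.2 (tsupport_deriv_subset h)), zero_smul]

theorem IsTest.deriv {η : ℝ → ℝ} (hη : IsTest η) : IsTest (deriv η) :=
  ⟨(contDiff_infty_iff_deriv.1 hη.1).2, hη.2.1.deriv, tsupport_deriv_subset.trans hη.2.2⟩

theorem IsTest.memLp {η : ℝ → ℝ} (hη : IsTest η) :
    MemLp (fun x => (η x : ℂ)) 2 halfLine :=
  (Complex.continuous_ofReal.comp hη.1.continuous).memLp_of_hasCompactSupport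
    (hη.2.1.comp_left Complex.ofReal_zero)

/-- A test function as an element of `L²(ℝ₊)`. -/
def IsTest.toL2 {η : ℝ → ℝ} (hη : IsTest η) : L2 := hη.memLp.toLp _

theorem IsTest.inner_toL2 {η : ℝ → ℝ} (hη : IsTest η) (f : L2) :
    inner ℂ hη.toL2 f = ∫ x, η x • f x ∂halfLine := by
  rw [L2.inner_def]
  refine integral_congr_ae ?_
  filter_upwards [hη.memLp.coeFn_toLp] with x hx
  rw [IsTest.toL2, hx]
  simp [mul_comm]

theorem IsTest.isWeakDeriv_toL2 {η : ℝ → ℝ} (hη : IsTest η) :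
    IsWeakDeriv hη.toL2 hη.deriv.toL2 := by
  have h : IsWeakDeriv (fun x => (η x : ℂ)) fun x => ((_root_.deriv η x : ℝ) : ℂ) :=
    isWeakDeriv_of_hasDerivAt
      (fun x => ((hη.1.differentiable (by simp) x).hasDerivAt).ofReal_comp)
      (Complex.continuous_ofReal.comp hη.deriv.1.continuous)
  exact h.congr hη.memLp.coeFn_toLp hη.deriv.memLp.coeFn_toLp

theorem L2.isWeakDeriv_iff {f g : L2} : IsWeakDeriv f g ↔
    ∀ (η : ℝ → ℝ) (hη : IsTest η), inner ℂ hη.deriv.toL2 f = -inner ℂ hη.toL2 g := by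
  simp only [IsTest.inner_toL2]
  rfl

theorem deriv1_eq {f g : L2} (h : IsWeakDeriv f g) :
    deriv1 ⟨f, g, h⟩ = g :=
  L2.weakDeriv_unique (isWeakDeriv_deriv1 _) h

/-- The graph of the weak derivative, as a subspace of `L²(ℝ₊) ⊕ L²(ℝ₊)`: the space `H¹(ℝ₊)` with
its Hilbert norm. -/
def graphH1 : Submodule ℂ (WithLp 2 (L2 × L2)) where
  carrier := {p | IsWeakDeriv p.fst p.snd}
  zero_mem' := isWeakDeriv_zero
  add_mem' := fun h h' => isWeakDeriv_add h h'
  smul_mem' := fun c _ h => isWeakDeriv_smul c h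

theorem isClosed_graphH1 : IsClosed (graphH1 : Set (WithLp 2 (L2 × L2))) := by
  have : (graphH1 : Set (WithLp 2 (L2 × L2))) = ⋂ (η : ℝ → ℝ) (hη : IsTest η),
      {p | inner ℂ hη.deriv.toL2 (WithLp.fstL 2 ℂ L2 L2 p) =
        -inner ℂ hη.toL2 (WithLp.sndL 2 ℂ L2 L2 p)} := by
    ext p
    simp only [mem_iInter]
    exact L2.isWeakDeriv_iff
  rw [this]
  refine isClosed_iInter fun η => isClosed_iInter fun hη => isClosed_eq ?_ ?_ <;> fun_prop

instance : CompleteSpace graphH1 := isClosed_graphH1.completeSpace_coe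

/-! ### The Neumann problem on the half-line -/

open ContinuousLinearMap in
/-- The equation `(K* K + s² J* J) p = J* f` is solvable, boundedly in `f`, if `‖J p‖² + ‖K p‖²` is
the squared norm of `p` and `Re s > 0`: the form `⟨K q, K p⟩ + s² ⟨J q, J p⟩` becomes coercive when
multiplied by `conj s`, so that the Lax–Milgram theorem applies. -/
theorem exists_solution_of_norm_sq_eq {V H : Type*} [NormedAddCommGroup V] [InnerProductSpace ℂ V]
    [CompleteSpace V] [NormedAddCommGroup H] [InnerProductSpace ℂ H] [CompleteSpace H]
    (J K : V →L[ℂ] H) (hnorm : ∀ p, ‖p‖ ^ 2 = ‖J p‖ ^ 2 + ‖K p‖ ^ 2) {s : ℂ} (hs : 0 < s.re) :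
    ∃ S : H →L[ℂ] V, ∀ f q,
      inner ℂ (K q) (K (S f)) + s ^ 2 * inner ℂ (J q) (J (S f)) = inner ℂ (J q) f := by
  let T : V →L[ℂ] V := conj s • (adjoint K ∘L K + s ^ 2 • (adjoint J ∘L J))
  have hs0 : s ≠ 0 := fun h => by simp [h] at hs
  have hinner : ∀ p : V, (inner ℂ (T p) p).re =
      s.re * ‖K p‖ ^ 2 + ‖s‖ ^ 2 * s.re * ‖J p‖ ^ 2 := by
    intro p
    have h1 : inner ℂ (T p) p = s * ((‖K p‖ ^ 2 : ℝ) : ℂ) +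
        ((‖s‖ ^ 2 : ℝ) : ℂ) * conj s * ((‖J p‖ ^ 2 : ℝ) : ℂ) := by
      have h2 : ((‖s‖ ^ 2 : ℝ) : ℂ) = conj s * s := by
        rw [← Complex.normSq_eq_norm_sq, Complex.normSq_eq_conj_mul_self]
      rw [h2]
      simp only [T, smul_apply, add_apply, comp_apply, inner_smul_left, inner_add_left,
        adjoint_inner_left, inner_self_eq_norm_sq_to_K, map_pow, Complex.conj_conj]
      push_cast
      simp only [Complex.coe_algebraMap]
      ring
    rw [h1]
    simp only [Complex.add_re, Complex.re_mul_ofReal, Complex.re_ofReal_mul, Complex.conj_re]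
  have hT : IsUnit T := by
    have hc : 0 < min s.re (‖s‖ ^ 2 * s.re) := by positivity
    refine isUnit_of_forall_le_norm_inner_map T (c := ⟨_, hc.le⟩) hc fun p => ?_
    refine le_trans ?_ ((Complex.re_le_norm _))
    rw [hinner, hnorm]
    change _ * min s.re (‖s‖ ^ 2 * s.re) ≤ _
    have h1 := mul_le_mul_of_nonneg_right (min_le_left s.re (‖s‖ ^ 2 * s.re)) (sq_nonneg ‖K p‖)
    have h2 := mul_le_mul_of_nonneg_right (min_le_right s.re (‖s‖ ^ 2 * s.re)) (sq_nonneg ‖J p‖)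
    linarith
  obtain ⟨U, hU⟩ := hT
  refine ⟨(U⁻¹ : (V →L[ℂ] V)ˣ).val ∘L (conj s • adjoint J), fun f q => ?_⟩
  set p : V := ((U⁻¹ : (V →L[ℂ] V)ˣ).val ∘L (conj s • adjoint J)) f with hp
  have hTp : T p = conj s • adjoint J f := by
    change T ((U⁻¹ : (V →L[ℂ] V)ˣ).val (conj s • adjoint J f)) = _
    rw [← hU, ← mul_apply_eq_comp, U.mul_inv]; rfl
  have hB : adjoint K (K p) + s ^ 2 • adjoint J (J p) = adjoint J f := by
    have hcs : conj s ≠ 0 := by simpa using hs0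
    exact smul_right_injective _ hcs hTp
  have h2 := congrArg (inner ℂ q) hB
  rwa [inner_add_right, inner_smul_right, adjoint_inner_right, adjoint_inner_right,
    adjoint_inner_right] at h2

/-- The weak form of `-φ'' + s² φ = f`, `φ'(0+) = 0`, has a solution depending boundedly on `f`. -/
theorem exists_weak_neumann {s : ℂ} (hs : 0 < s.re) : ∃ N : L2 →L[ℂ] L2, ∀ f : L2,
    ∃ h : N f ∈ H1, ∀ ψ : H1, inner ℂ (deriv1 ψ) (deriv1 ⟨N f, h⟩) + s ^ 2 * inner ℂ (ψ : L2) (N f)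
      = inner ℂ (ψ : L2) f := by
  let J : graphH1 →L[ℂ] L2 := WithLp.fstL 2 ℂ L2 L2 ∘L graphH1.subtypeL
  let K : graphH1 →L[ℂ] L2 := WithLp.sndL 2 ℂ L2 L2 ∘L graphH1.subtypeL
  obtain ⟨S, hS⟩ := exists_solution_of_norm_sq_eq J K (fun p =>
    WithLp.prod_norm_sq_eq_of_L2 (p : WithLp 2 (L2 × L2))) hs
  refine ⟨J ∘L S, fun f => ⟨⟨K (S f), (S f).2⟩, fun ψ => ?_⟩⟩
  have h1 : deriv1 ⟨J (S f), K (S f), (S f).2⟩ = K (S f) := deriv1_eq (S f).2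
  change inner ℂ _ (deriv1 ⟨J (S f), K (S f), (S f).2⟩) + _ = _
  rw [h1]
  exact hS f ⟨WithLp.toLp 2 ((ψ : L2), deriv1 ψ), isWeakDeriv_deriv1 ψ⟩

theorem mem_H2_of_isWeakDeriv {f f' f'' : L2} (h : IsWeakDeriv f f') (h' : IsWeakDeriv f' f'') :
    ∃ hf : f ∈ H2, (derivH2 ⟨f, hf⟩ : L2) = f' ∧ deriv2 ⟨f, hf⟩ = f'' := by
  have e : deriv1 ⟨f, f', h⟩ = f' := deriv1_eq h
  have hf : f ∈ H2 := mem_H2.2 ⟨⟨f', h⟩, by rw [e]; exact ⟨f'', h'⟩⟩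
  have e1 : (derivH2 ⟨f, hf⟩ : L2) = f' := e
  refine ⟨hf, e1, ?_⟩
  refine L2.weakDeriv_unique (isWeakDeriv_deriv1 (derivH2 ⟨f, hf⟩)) ?_
  rw [e1]; exact h'

theorem trace_eq_of_hasTrace (f : H1) {a : ℂ} (h : HasTrace (⇑(f : L2)) a) : trace f = a :=
  (hasTrace_trace f).unique h

/-- Green's identity on `H²(ℝ₊)`, with one integration by parts. -/
theorem inner_deriv2 (ψ : H1) (φ : H2) : inner ℂ (ψ : L2) (deriv2 φ) =
    -inner ℂ (deriv1 ψ) (derivH2 φ : L2) - conj (trace ψ) * trace (derivH2 φ) := by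
  have h := inner_deriv1_add ψ (derivH2 φ)
  have e : deriv2 φ = deriv1 (derivH2 φ) := rfl
  rw [e]
  linear_combination h

theorem deriv1_incl (φ : H2) : deriv1 (incl φ) = (derivH2 φ : L2) := rfl
theorem coe_incl (φ : H2) : (incl φ : L2) = (φ : L2) := rfl

/-! ### The decaying exponential -/

theorem isWeakDeriv_expL2 {z : ℂ} (hz : z ∈ Complex.slitPlane) :
    IsWeakDeriv (expL2 hz) (⇑(-sqrtPos z • expL2 hz)) := by
  have hE := (memLp_exp (sqrtPos_re_pos hz)).coeFn_toLp
  have h : IsWeakDeriv (fun x : ℝ => Complex.exp (-sqrtPos z * x) / sqrtPos z)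
      fun x : ℝ => -sqrtPos z * (Complex.exp (-sqrtPos z * x) / sqrtPos z) := by
    refine isWeakDeriv_of_hasDerivAt (fun x => ?_) (by fun_prop)
    have h1 : HasDerivAt (fun x : ℝ => -sqrtPos z * (x : ℂ)) (-sqrtPos z * 1) x :=
      (Complex.ofRealCLM.hasDerivAt (x := x)).const_mul _
    exact (h1.cexp.div_const (sqrtPos z)).congr_deriv (by ring)
  refine h.congr hE ?_
  filter_upwards [Lp.coeFn_smul (-sqrtPos z) (expL2 hz), hE] with x h1 h2
  rw [h1, Pi.smul_apply, expL2, h2, smul_eq_mul]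

theorem hasTrace_expL2 {z : ℂ} (hz : z ∈ Complex.slitPlane) :
    HasTrace (expL2 hz) (1 / sqrtPos z) :=
  ⟨_, Continuous.continuousOn (by fun_prop), (memLp_exp (sqrtPos_re_pos hz)).coeFn_toLp, by simp⟩

theorem expL2_mem_H1 {z : ℂ} (hz : z ∈ Complex.slitPlane) : expL2 hz ∈ H1 :=
  ⟨_, isWeakDeriv_expL2 hz⟩

theorem deriv1_expL2 {z : ℂ} (hz : z ∈ Complex.slitPlane) :
    deriv1 ⟨expL2 hz, expL2_mem_H1 hz⟩ = -sqrtPos z • expL2 hz :=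
  deriv1_eq (isWeakDeriv_expL2 hz)

theorem trace_expL2 {z : ℂ} (hz : z ∈ Complex.slitPlane) :
    trace ⟨expL2 hz, expL2_mem_H1 hz⟩ = 1 / sqrtPos z :=
  trace_eq_of_hasTrace _ (hasTrace_expL2 hz)

theorem sqrtPos_ne_zero {z : ℂ} (hz : z ∈ Complex.slitPlane) : sqrtPos z ≠ 0 := fun h => by
  have := sqrtPos_re_pos hz
  simp [h] at this

theorem sqrtPos_conj {z : ℂ} (hz : z ∈ Complex.slitPlane) :
    sqrtPos (conj z) = conj (sqrtPos z) :=
  (eq_sqrtPos (by rw [← map_pow, sqrtPos_sq]) (by simpa using sqrtPos_re_pos hz)).symm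

theorem expL2_ne_zero {z : ℂ} (hz : z ∈ Complex.slitPlane) : expL2 hz ≠ 0 := by
  intro h
  have h1 : (⟨expL2 hz, expL2_mem_H1 hz⟩ : H1) = 0 := Subtype.ext h
  have h2 := trace_expL2 hz
  rw [h1, map_zero] at h2
  exact one_div_ne_zero (sqrtPos_ne_zero hz) h2.symm

theorem expL2_mem_H2 {z : ℂ} (hz : z ∈ Complex.slitPlane) : expL2 hz ∈ H2 :=
  (mem_H2_of_isWeakDeriv (isWeakDeriv_expL2 hz)
    (isWeakDeriv_smul _ (isWeakDeriv_expL2 hz))).choose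

/-- `e^{-√z x} / √z` as an element of `H²(ℝ₊)`. -/
def expH2 {z : ℂ} (hz : z ∈ Complex.slitPlane) : H2 := ⟨expL2 hz, expL2_mem_H2 hz⟩

theorem deriv2_expH2 {z : ℂ} (hz : z ∈ Complex.slitPlane) :
    deriv2 (expH2 hz) = z • expL2 hz := by
  rw [expH2, (mem_H2_of_isWeakDeriv (isWeakDeriv_expL2 hz)
    (isWeakDeriv_smul _ (isWeakDeriv_expL2 hz))).choose_spec.2, smul_smul, neg_mul_neg, ← pow_two,
    sqrtPos_sq]

theorem trace_expH2 {z : ℂ} (hz : z ∈ Complex.slitPlane) :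
    trace (incl (expH2 hz)) = 1 / sqrtPos z := trace_expL2 hz

theorem trace_derivH2_expH2 {z : ℂ} (hz : z ∈ Complex.slitPlane) :
    trace (derivH2 (expH2 hz)) = -1 := by
  have h : derivH2 (expH2 hz) = -sqrtPos z • incl (expH2 hz) := Subtype.ext (deriv1_expL2 hz)
  rw [h, map_smul, trace_expH2, smul_eq_mul]
  field_simp [sqrtPos_ne_zero hz]

/-! ### The Neumann problem on the half-line: regularity, boundary value, uniqueness -/

/-- The boundary values of `φ` are read off from `-φ'' + z φ` by integrating it against the
decaying solution of the homogeneous equation. -/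
theorem inner_expL2_conj {z : ℂ} (hz : z ∈ Complex.slitPlane) (φ : H2) :
    inner ℂ (expL2 (conj_mem hz)) (-deriv2 φ + z • (φ : L2)) =
      trace (incl φ) + trace (derivH2 φ) / sqrtPos z := by
  have h1 := inner_deriv2 ⟨_, expL2_mem_H1 (conj_mem hz)⟩ φ
  have h2 := inner_deriv1_add ⟨_, expL2_mem_H1 (conj_mem hz)⟩ (incl φ)
  rw [deriv1_expL2, trace_expL2, sqrtPos_conj hz] at h1 h2
  rw [deriv1_incl, coe_incl] at h2
  simp only [inner_smul_left, map_div₀, map_one, map_neg, Complex.conj_conj] at h1 h2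
  rw [inner_add_right, inner_neg_right, inner_smul_right, h1]
  have hs := sqrtPos_ne_zero hz
  have hsq := sqrtPos_sq z
  generalize hA : inner ℂ (expL2 (conj_mem hz)) (φ : L2) = A at *
  generalize hB : inner ℂ (expL2 (conj_mem hz)) (derivH2 φ : L2) = B at *
  have h3 : sqrtPos z * B = z * A - trace (incl φ) := by
    have h4 : sqrtPos z * (1 / sqrtPos z) = 1 := by field_simp
    linear_combination sqrtPos z * h2 + A * hsq - trace (incl φ) * h4
  rw [neg_mul, h3]
  ring

/-- `-D² + z` with the Neumann condition is injective: the energy identity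
`‖φ'‖² + z ‖φ‖² = 0` forces `φ = 0` unless `z ≤ 0`. -/
theorem eq_zero_of_deriv2_eq_smul {z : ℂ} (hz : z ∈ Complex.slitPlane) {φ : H2}
    (h : deriv2 φ = z • (φ : L2)) (h0 : trace (derivH2 φ) = 0) : φ = 0 := by
  have h1 := inner_deriv2 (incl φ) φ
  rw [h0, mul_zero, sub_zero, deriv1_incl, coe_incl, h, inner_smul_right,
    inner_self_eq_norm_sq_to_K, inner_self_eq_norm_sq_to_K] at h1
  have h2 : ‖(φ : L2)‖ ^ 2 = 0 := by
    by_contra hne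
    have hpos : 0 < ‖(φ : L2)‖ ^ 2 := lt_of_le_of_ne (sq_nonneg _) (Ne.symm hne)
    have h3 : z * ((‖(φ : L2)‖ ^ 2 : ℝ) : ℂ) = ((-‖(derivH2 φ : L2)‖ ^ 2 : ℝ) : ℂ) := by
      push_cast; exact h1
    have hre := congrArg Complex.re h3
    have him := congrArg Complex.im h3
    rw [Complex.re_mul_ofReal, Complex.ofReal_re] at hre
    rw [Complex.im_mul_ofReal, Complex.ofReal_im] at him
    rcases Complex.mem_slitPlane_iff.1 hz with hz | hz
    · nlinarith [mul_pos hz hpos, sq_nonneg ‖(derivH2 φ : L2)‖]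
    · exact mul_ne_zero hz hne him
  exact Subtype.ext (norm_eq_zero.1 (pow_eq_zero_iff two_ne_zero |>.1 h2))

/-- The resolvent of the Neumann Laplacian on the half-line. -/
theorem exists_neumann {z : ℂ} (hz : z ∈ Complex.slitPlane) : ∃ N : L2 →L[ℂ] L2, ∀ f : L2,
    ∃ h : N f ∈ H2, trace (derivH2 ⟨N f, h⟩) = 0 ∧ -deriv2 ⟨N f, h⟩ + z • N f = f := by
  obtain ⟨N, hN⟩ := exists_weak_neumann (sqrtPos_re_pos hz)
  refine ⟨N, fun f => ?_⟩
  obtain ⟨h, hw⟩ := hN f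
  rw [sqrtPos_sq] at hw
  have hd : IsWeakDeriv (deriv1 ⟨N f, h⟩) (⇑(z • N f - f)) := by
    refine L2.isWeakDeriv_iff.2 fun η hη => ?_
    have h1 := hw ⟨_, _, hη.isWeakDeriv_toL2⟩
    rw [deriv1_eq hη.isWeakDeriv_toL2] at h1
    rw [inner_sub_right, inner_smul_right, ← h1]
    ring
  obtain ⟨h2, e1, e2⟩ := mem_H2_of_isWeakDeriv (isWeakDeriv_deriv1 ⟨N f, h⟩) hd
  refine ⟨h2, ?_, by rw [e2]; abel⟩
  have h3 := inner_deriv2 ⟨_, expL2_mem_H1 hz⟩ ⟨N f, h2⟩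
  rw [e1, e2, inner_sub_right, inner_smul_right, ← hw ⟨_, expL2_mem_H1 hz⟩, trace_expL2] at h3
  have h4 : conj (1 / sqrtPos z) * trace (derivH2 ⟨N f, h2⟩) = 0 := by linear_combination h3
  exact (mul_eq_zero.1 h4).resolve_left (by simpa using sqrtPos_ne_zero hz)

/-! ### Resolvents and self-adjointness of unbounded operators -/

section Abstract

variable {E : Type*} [NormedAddCommGroup E] [InnerProductSpace ℂ E]

theorem isResolventAt_of_injective {T : E →ₗ.[ℂ] E} {z : ℂ} {R : E →L[ℂ] E}
    (h : ∀ v : E, ∃ h : R v ∈ T.domain, -T ⟨R v, h⟩ + z • R v = v)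
    (h0 : ∀ u : T.domain, T u = z • (u : E) → u = 0) : IsResolventAt T z R := by
  refine ⟨h, fun u => ?_⟩
  obtain ⟨hv, e⟩ := h (-T u + z • (u : E))
  set v : T.domain := ⟨R (-T u + z • (u : E)), hv⟩ with hvdef
  have h1 : T (v - u) = z • ((v - u : T.domain) : E) := by
    have e' : z • (v : E) - T v = z • (u : E) - T u := by
      rw [← neg_add_eq_sub, ← neg_add_eq_sub]; exact e
    rw [T.map_sub, Submodule.coe_sub, smul_sub, sub_eq_sub_iff_add_eq_add, add_comm]
    exact (sub_eq_sub_iff_add_eq_add.1 e').symm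
  exact congrArg Subtype.val (sub_eq_zero.1 (h0 _ h1))

theorem eq_zero_of_mem_resolventSet {T : E →ₗ.[ℂ] E} {z : ℂ} (hz : z ∈ resolventSet T)
    {u : T.domain} (hu : T u = z • (u : E)) : (u : E) = 0 := by
  obtain ⟨R, hR⟩ := hz
  rw [← hR.2 u, hu, neg_add_cancel, map_zero]

theorem resolventOp_eq {T : E →ₗ.[ℂ] E} {z : ℂ} {R : E →L[ℂ] E} (h : IsResolventAt T z R) :
    resolventOp T z = R :=
  (isResolventAt_resolventOp ⟨R, h⟩).unique h

theorem im_eq_zero_of_isFormalAdjoint {T : E →ₗ.[ℂ] E} (hT : T.IsFormalAdjoint T) {z : ℂ}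
    {u : T.domain} (hu : T u = z • (u : E)) (hne : (u : E) ≠ 0) : z.im = 0 := by
  have h := hT u u
  rw [hu, inner_smul_left, inner_smul_right] at h
  exact Complex.conj_eq_iff_im.1 (mul_right_cancel₀ (inner_self_ne_zero.2 hne) h)

/-- The basic criterion for self-adjointness. Density of the domain need not be assumed: a vector
`(-T + z̄) u` orthogonal to the domain makes `u` orthogonal to the range of `-T + z`. -/
theorem isSelfAdjoint_of_surjective [CompleteSpace E] {T : E →ₗ.[ℂ] E} (hT : T.IsFormalAdjoint T)
    {z : ℂ} (h : ∀ v : E, ∃ u : T.domain, -T u + z • (u : E) = v)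
    (h' : ∀ v : E, ∃ u : T.domain, -T u + conj z • (u : E) = v) : IsSelfAdjoint T := by
  have hsymm : ∀ (c : ℂ) (x y : T.domain), inner ℂ (-T x + c • (x : E)) (y : E) =
      inner ℂ (x : E) (-T y + conj c • (y : E)) := by
    intro c x y
    rw [inner_add_left, inner_add_right, inner_neg_left, inner_neg_right, hT x y, inner_smul_left,
      inner_smul_right]
  have hdense : Dense (T.domain : Set E) := by
    rw [Submodule.dense_iff_topologicalClosure_eq_top, Submodule.topologicalClosure_eq_top_iff,
      Submodule.eq_bot_iff]
    intro v hv
    obtain ⟨u, rfl⟩ := h' v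
    have hu : (u : E) = 0 := by
      obtain ⟨x, hx⟩ := h (u : E)
      have h1 := (Submodule.mem_orthogonal' _ _).1 hv x x.2
      rw [hsymm, Complex.conj_conj, hx] at h1
      exact inner_self_eq_zero.1 h1
    have hu0 : u = 0 := Subtype.ext hu
    simp [hu0]
  have hle : T ≤ T.adjoint := hT.le_adjoint hdense
  have hdom : T.adjoint.domain ≤ T.domain := by
    intro y hy
    obtain ⟨u, hu⟩ := h (-T.adjoint ⟨y, hy⟩ + z • y)
    obtain ⟨x, hx⟩ := h' (y - u)
    have h1 : inner ℂ y (-T x + conj z • (x : E)) = inner ℂ (u : E) (-T x + conj z • (x : E)) := by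
      rw [← hsymm, hu, inner_add_left, inner_add_right, inner_neg_left, inner_neg_right,
        LinearPMap.adjoint_isFormalAdjoint hdense ⟨y, hy⟩ x, inner_smul_left, inner_smul_right]
    rw [hx, ← sub_eq_zero, ← inner_sub_left] at h1
    rw [sub_eq_zero.1 (inner_self_eq_zero.1 h1)]
    exact u.2
  exact (LinearPMap.eq_of_le_of_domain_eq hle (le_antisymm hle.1 hdom)).symm

end Abstract

section Model

variable {𝔥 : Type*} [NormedAddCommGroup 𝔥] [InnerProductSpace ℂ 𝔥]

/-! ### The resolvent of a symmetric matrix -/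

theorem sub_resolvent_apply {L : 𝔥 →ₗ[ℂ] 𝔥} {z : ℂ} (hz : z ∉ spectrum ℂ L) (v : 𝔥) :
    z • resolvent L z v - L (resolvent L z v) = v := by
  have h := Ring.mul_inverse_cancel _ (spectrum.notMem_iff.1 hz)
  exact congrArg (fun M : Module.End ℂ 𝔥 => M v) h

theorem resolvent_sub_apply {L : 𝔥 →ₗ[ℂ] 𝔥} {z : ℂ} (hz : z ∉ spectrum ℂ L) (v : 𝔥) :
    resolvent L z (z • v - L v) = v := by
  have h := Ring.inverse_mul_cancel _ (spectrum.notMem_iff.1 hz)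
  exact congrArg (fun M : Module.End ℂ 𝔥 => M v) h

theorem conj_notMem_spectrum [FiniteDimensional ℂ 𝔥] {L : 𝔥 →ₗ[ℂ] 𝔥} (hL : L.IsSymmetric) {z : ℂ}
    (hz : z ∉ spectrum ℂ L) : conj z ∉ spectrum ℂ L := by
  intro h
  have h1 := hL.conj_eigenvalue_eq_self (Module.End.hasEigenvalue_iff_mem_spectrum.2 h)
  rw [Complex.conj_conj] at h1
  exact hz (by rwa [h1])

theorem notMem_spectrum_of_im_ne_zero [FiniteDimensional ℂ 𝔥] {L : 𝔥 →ₗ[ℂ] 𝔥}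
    (hL : L.IsSymmetric) {z : ℂ} (hz : z.im ≠ 0) : z ∉ spectrum ℂ L := fun h =>
  hz (Complex.conj_eq_iff_im.1
    (hL.conj_eigenvalue_eq_self (Module.End.hasEigenvalue_iff_mem_spectrum.2 h)))

theorem inner_resolvent_conj [FiniteDimensional ℂ 𝔥] {L : 𝔥 →ₗ[ℂ] 𝔥} (hL : L.IsSymmetric) {z : ℂ}
    (hz : z ∉ spectrum ℂ L) (v w : 𝔥) :
    inner ℂ (resolvent L (conj z) v) w = inner ℂ v (resolvent L z w) := by
  conv_lhs => rw [← sub_resolvent_apply hz w]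
  conv_rhs => rw [← sub_resolvent_apply (conj_notMem_spectrum hL hz) v]
  rw [inner_sub_left, inner_sub_right, inner_smul_left, inner_smul_right, hL, Complex.conj_conj]

/-! ### The operators `A₀` and `A` -/

theorem space_ext {u v : Space 𝔥} (h1 : u.fst = v.fst) (h2 : u.snd = v.snd) : u = v :=
  (WithLp.equiv 2 _).injective (Prod.ext h1 h2)

theorem inner_space (u v : Space 𝔥) :
    inner ℂ u v = inner ℂ u.fst v.fst + inner ℂ u.snd v.snd :=
  WithLp.prod_inner_apply u v

theorem mem_domain_A₀ {L : 𝔥 →ₗ[ℂ] 𝔥} {u : Space 𝔥} : u ∈ (A₀ L).domain ↔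
    ∃ h : u.fst ∈ H2, trace (derivH2 ⟨u.fst, h⟩) = 0 := Iff.rfl

theorem snd_A₀ {L : 𝔥 →ₗ[ℂ] 𝔥} {u : Space 𝔥} (h : u ∈ (A₀ L).domain) :
    (A₀ L ⟨u, h⟩).snd = L u.snd := rfl

theorem mem_domain_A {L : 𝔥 →ₗ[ℂ] 𝔥} {w : 𝔥} {θ : ℝ} {u : Space 𝔥} :
    u ∈ (A L w θ).domain ↔ ∃ h : u.fst ∈ H2,
      θ * trace (derivH2 ⟨u.fst, h⟩) + trace (incl ⟨u.fst, h⟩) = inner ℂ w u.snd := Iff.rfl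

theorem fst_A {L : 𝔥 →ₗ[ℂ] 𝔥} {w : 𝔥} {θ : ℝ} {u : Space 𝔥} (h : u ∈ (A L w θ).domain)
    (h' : u.fst ∈ H2) : (A L w θ ⟨u, h⟩).fst = deriv2 ⟨u.fst, h'⟩ := rfl

theorem snd_A {L : 𝔥 →ₗ[ℂ] 𝔥} {w : 𝔥} {θ : ℝ} {u : Space 𝔥} (h : u ∈ (A L w θ).domain)
    (h' : u.fst ∈ H2) :
    (A L w θ ⟨u, h⟩).snd = L u.snd + trace (derivH2 ⟨u.fst, h'⟩) • w := rfl

theorem A₀dot_le_A (L : 𝔥 →ₗ[ℂ] 𝔥) (w : 𝔥) (θ : ℝ) : A₀dot L w ≤ A L w θ := by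
  refine ⟨?_, ?_⟩
  · rintro u ⟨⟨h, e⟩, h1, e1⟩
    refine mem_domain_A.2 ⟨h1, ?_⟩
    rw [e1, mul_zero, zero_add]
    exact sub_eq_zero.1 e
  · rintro ⟨u, hu⟩ ⟨v, hv⟩ (rfl : u = v)
    obtain ⟨h1, e1⟩ := hu.2
    refine space_ext rfl ?_
    rw [snd_A hv h1, e1, zero_smul, add_zero]
    rfl

/-- `A` is symmetric: the boundary terms of Green's identity cancel against the coupling terms
by the boundary condition, `θ` being real. -/
theorem isFormalAdjoint_A {L : 𝔥 →ₗ[ℂ] 𝔥} (hL : L.IsSymmetric) (w : 𝔥) (θ : ℝ) :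
    (A L w θ).IsFormalAdjoint (A L w θ) := by
  rintro ⟨u, mu⟩ ⟨v, mv⟩
  obtain ⟨hu, eu⟩ := mem_domain_A.1 mu
  obtain ⟨hv, ev⟩ := mem_domain_A.1 mv
  rw [inner_space, inner_space, fst_A mu hu, snd_A mu hu, fst_A mv hv, snd_A mv hv]
  have h1 := inner_deriv2 (incl ⟨u.fst, hu⟩) ⟨v.fst, hv⟩
  have h2 := congrArg conj (inner_deriv2 (incl ⟨v.fst, hv⟩) ⟨u.fst, hu⟩)
  have eu' := congrArg conj eu
  simp only [map_sub, map_neg, map_mul, map_add, inner_conj_symm, Complex.conj_conj,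
    Complex.conj_ofReal, coe_incl, deriv1_incl] at h1 h2 eu'
  rw [inner_add_left, inner_add_right, inner_smul_left, inner_smul_right, hL]
  simp only [h1, h2]
  linear_combination conj (trace (derivH2 ⟨u.fst, hu⟩)) * (-ev)
    + trace (derivH2 ⟨v.fst, hv⟩) * eu'

theorem G_fst (L : 𝔥 →ₗ[ℂ] 𝔥) (w : 𝔥) {z : ℂ} (hz : z ∈ Complex.slitPlane) :
    (G L w hz).fst = expL2 hz := rfl

theorem G_snd (L : 𝔥 →ₗ[ℂ] 𝔥) (w : 𝔥) {z : ℂ} (hz : z ∈ Complex.slitPlane) :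
    (G L w hz).snd = -(resolvent L z w) := rfl

theorem G_ne_zero (L : 𝔥 →ₗ[ℂ] 𝔥) (w : 𝔥) {z : ℂ} (hz : z ∈ Complex.slitPlane) :
    G L w hz ≠ 0 := fun h => expL2_ne_zero hz (congrArg WithLp.fst h)

/-- At a zero of `θ + Γ(z)` the vector `G_z` is an eigenvector of `A`. -/
theorem G_mem_eigenspace {L : 𝔥 →ₗ[ℂ] 𝔥} (w : 𝔥) {θ : ℝ} {z : ℂ} (hz : z ∈ Complex.slitPlane)
    (hzL : z ∉ spectrum ℂ L) (h0 : (θ : ℂ) + Γ L w z = 0) :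
    ∃ h : G L w hz ∈ (A L w θ).domain, A L w θ ⟨G L w hz, h⟩ = z • G L w hz := by
  have hd : trace (derivH2 ⟨(G L w hz).fst, expL2_mem_H2 hz⟩) = -1 := trace_derivH2_expH2 hz
  have ht : trace (incl ⟨(G L w hz).fst, expL2_mem_H2 hz⟩) = 1 / sqrtPos z := trace_expH2 hz
  have hm : G L w hz ∈ (A L w θ).domain := by
    refine mem_domain_A.2 ⟨expL2_mem_H2 hz, ?_⟩
    rw [hd, ht, G_snd, inner_neg_right]
    rw [Γ] at h0
    linear_combination -h0
  refine ⟨hm, space_ext ?_ ?_⟩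
  · rw [fst_A hm (expL2_mem_H2 hz)]
    exact deriv2_expH2 hz
  · have h1 := sub_resolvent_apply hzL w
    rw [snd_A hm (expL2_mem_H2 hz), hd, WithLp.smul_snd, G_snd, map_neg, neg_smul,
      one_smul, smul_neg]
    nth_rw 2 [← h1]
    abel

/-- For nonreal `z`, `θ + Γ(z)` cannot vanish, since `A` has no nonreal eigenvalues. -/
theorem add_Γ_ne_zero {L : 𝔥 →ₗ[ℂ] 𝔥} (hL : L.IsSymmetric) (w : 𝔥) (θ : ℝ) {z : ℂ}
    (hz : z ∈ Complex.slitPlane) (hzL : z ∉ spectrum ℂ L) (him : z.im ≠ 0) :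
    (θ : ℂ) + Γ L w z ≠ 0 := by
  intro h0
  obtain ⟨h, e⟩ := G_mem_eigenspace w hz hzL h0
  exact him (im_eq_zero_of_isFormalAdjoint (isFormalAdjoint_A hL w θ) e (G_ne_zero L w hz))

variable [FiniteDimensional ℂ 𝔥]

/-- The resolvent of `A₀` exists, and the adjoint of `τ (-A₀ + z)⁻¹` is represented by `G_{z*}`:
the coupling functional satisfies `τ ((-A₀ + z)⁻¹ v) = ⟨G_{z*}, v⟩`. -/
theorem exists_resolvent_A₀ {L : 𝔥 →ₗ[ℂ] 𝔥} (hL : L.IsSymmetric) {z : ℂ}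
    (hz : z ∈ Complex.slitPlane) (hzL : z ∉ spectrum ℂ L) :
    ∃ R : Space 𝔥 →L[ℂ] Space 𝔥, IsResolventAt (A₀ L) z R ∧
      ∀ (w : 𝔥) (v : Space 𝔥) (h : (R v).fst ∈ H2), trace (incl ⟨(R v).fst, h⟩) -
        inner ℂ w (R v).snd = inner ℂ (G L w (conj_mem hz)) v := by
  obtain ⟨N, hN⟩ := exists_neumann hz
  let R : Space 𝔥 →L[ℂ] Space 𝔥 :=
    (WithLp.prodContinuousLinearEquiv 2 ℂ L2 𝔥).symm.toContinuousLinearMap ∘L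
      (N.prodMap (LinearMap.toContinuousLinearMap (resolvent L z))) ∘L
        (WithLp.prodContinuousLinearEquiv 2 ℂ L2 𝔥).toContinuousLinearMap
  have hR2 : ∀ v, (R v).snd = resolvent L z v.snd := fun v => rfl
  refine ⟨R, isResolventAt_of_injective (fun v => ?_) ?_, fun w v h => ?_⟩
  · obtain ⟨h, e1, e2⟩ := hN v.fst
    have hm : R v ∈ (A₀ L).domain := mem_domain_A₀.2 ⟨h, e1⟩
    refine ⟨hm, space_ext e2 ?_⟩
    have h1 := sub_resolvent_apply hzL v.snd
    rw [WithLp.add_snd, WithLp.neg_snd, WithLp.smul_snd, snd_A₀ hm, hR2, neg_add_eq_sub, h1]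
  · rintro ⟨u, h, e⟩ hu
    have h1 : deriv2 ⟨u.fst, h⟩ = z • u.fst := congrArg WithLp.fst hu
    have h2 : L u.snd = z • u.snd := congrArg WithLp.snd hu
    refine Subtype.ext (space_ext ?_ ?_)
    · exact congrArg Subtype.val (eq_zero_of_deriv2_eq_smul hz (φ := ⟨u.fst, h⟩) h1 e)
    · change u.snd = 0
      rw [← resolvent_sub_apply hzL u.snd, h2, sub_self, map_zero]
  · obtain ⟨h', e1, e2⟩ := hN v.fst
    have h1 := inner_expL2_conj hz ⟨N v.fst, h'⟩
    rw [e1, zero_div, add_zero, e2] at h1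
    rw [inner_space, G_fst, G_snd, inner_neg_left, inner_resolvent_conj hL hzL, h1,
      hR2, ← sub_eq_add_neg]
    rfl

/-- Krein's formula. Exactly one multiple of `G_z`, a formal solution of the homogeneous equation
with derivative `-1` at `0`, corrects `(-A₀ + z)⁻¹ v` to an element of the domain of `A`. -/
theorem isResolventAt_A {L : 𝔥 →ₗ[ℂ] 𝔥} (hL : L.IsSymmetric) (w : 𝔥) {θ : ℝ} {z : ℂ}
    (hz : z ∈ Complex.slitPlane) (hzL : z ∉ spectrum ℂ L) (h0 : (θ : ℂ) + Γ L w z ≠ 0) :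
    IsResolventAt (A L w θ) z (resolventOp (A₀ L) z + ((θ : ℂ) + Γ L w z)⁻¹ •
      InnerProductSpace.rankOne ℂ (G L w hz) (G L w (conj_mem hz))) := by
  obtain ⟨R, hR, htr⟩ := exists_resolvent_A₀ hL hz hzL
  rw [resolventOp_eq hR]
  refine isResolventAt_of_injective (fun v => ?_) ?_
  · obtain ⟨⟨h, e⟩, e'⟩ := hR.1 v
    have ht := htr w v h
    set c : ℂ := ((θ : ℂ) + Γ L w z)⁻¹ * inner ℂ (G L w (conj_mem hz)) v with hc
    have hv : (R + ((θ : ℂ) + Γ L w z)⁻¹ •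
        InnerProductSpace.rankOne ℂ (G L w hz) (G L w (conj_mem hz))) v = R v + c • G L w hz := by
      simp [hc, mul_smul]
    rw [hv]
    have hc' : ((θ : ℂ) + Γ L w z) * c = inner ℂ (G L w (conj_mem hz)) v := by
      rw [hc, mul_inv_cancel_left₀ h0]
    set φ : H2 := ⟨(R v).fst, h⟩ with hφ
    have hmem : (R v + c • G L w hz).fst ∈ H2 := (φ + c • expH2 hz).2
    have hφ' : (⟨(R v + c • G L w hz).fst, hmem⟩ : H2) = φ + c • expH2 hz := rfl
    have hd : trace (derivH2 ⟨(R v + c • G L w hz).fst, hmem⟩) = -c := by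
      rw [hφ', map_add, map_add, map_smul, map_smul, trace_derivH2_expH2, e]
      simp
    have hi : trace (incl ⟨(R v + c • G L w hz).fst, hmem⟩) =
        trace (incl φ) + c * (1 / sqrtPos z) := by
      rw [hφ', map_add, map_add, map_smul, map_smul, trace_expH2, smul_eq_mul]
    have hs : (R v + c • G L w hz).snd = (R v).snd - c • resolvent L z w := by
      rw [WithLp.add_snd, WithLp.smul_snd, G_snd, smul_neg, sub_eq_add_neg]
    have hm : R v + c • G L w hz ∈ (A L w θ).domain := by
      refine mem_domain_A.2 ⟨hmem, ?_⟩
      rw [hd, hi, hs, inner_sub_right, inner_smul_right]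
      rw [← ht, Γ] at hc'
      linear_combination -hc'
    refine ⟨hm, space_ext ?_ ?_⟩
    · have e1 : -deriv2 φ + z • (φ : L2) = v.fst := congrArg WithLp.fst e'
      have e2 : deriv2 (⟨(R v + c • G L w hz).fst, hmem⟩ : H2) =
          deriv2 φ + c • z • expL2 hz := by
        rw [hφ', map_add, map_smul, deriv2_expH2]
      rw [WithLp.add_fst, WithLp.neg_fst, WithLp.smul_fst, fst_A hm hmem, e2, ← e1, WithLp.add_fst,
        WithLp.smul_fst, G_fst, smul_comm c z, smul_add]
      abel
    · have e1 : -L (R v).snd + z • (R v).snd = v.snd := congrArg WithLp.snd e'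
      have e2 := congrArg (c • ·) (sub_resolvent_apply hzL w)
      simp only [smul_sub] at e2
      rw [WithLp.add_snd, WithLp.neg_snd, WithLp.smul_snd, snd_A hm hmem, hd, hs, ← e1,
        map_sub, map_smul,
        neg_smul, ← e2, smul_sub, smul_comm c z]
      abel
  · rintro ⟨u, h, e⟩ hu
    set d := trace (derivH2 ⟨u.fst, h⟩) with hd
    have h1 : deriv2 ⟨u.fst, h⟩ = z • u.fst := congrArg WithLp.fst hu
    have h2 : L u.snd + d • w = z • u.snd := congrArg WithLp.snd hu
    -- Removing the multiple of the exponential with the same derivative at `0` leaves a solution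
    -- of the homogeneous Neumann problem.
    have h3 : (⟨u.fst, h⟩ : H2) + d • expH2 hz = 0 := by
      refine eq_zero_of_deriv2_eq_smul hz ?_ ?_
      · rw [map_add, map_smul, deriv2_expH2, h1, Submodule.coe_add, Submodule.coe_smul, smul_add,
          smul_comm d z]
        rfl
      · rw [map_add, map_add, map_smul, map_smul, trace_derivH2_expH2, ← hd]
        simp
    have h4 : u.snd = d • resolvent L z w := by
      rw [← map_smul, ← resolvent_sub_apply hzL u.snd, ← h2, add_sub_cancel_left]
    have h5 : trace (incl ⟨u.fst, h⟩) = -d * (1 / sqrtPos z) := by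
      rw [eq_neg_of_add_eq_zero_left h3, map_neg, map_neg, map_smul, map_smul, trace_expH2,
        smul_eq_mul, neg_mul]
    have h6 : d = 0 := by
      rw [h5, h4, inner_smul_right] at e
      have : ((θ : ℂ) + Γ L w z) * d = 0 := by
        rw [Γ]
        linear_combination e
      exact (mul_eq_zero.1 this).resolve_left h0
    rw [h6, zero_smul, add_zero] at h3
    rw [h6, zero_smul] at h4
    exact Subtype.ext (space_ext (congrArg Subtype.val h3) h4)

/-- Krein's formula at `±i` provides the surjectivity that turns symmetry into
self-adjointness. -/
theorem isSelfAdjoint_A [CompleteSpace 𝔥] {L : 𝔥 →ₗ[ℂ] 𝔥} (hL : L.IsSymmetric) (w : 𝔥) (θ : ℝ) :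
    IsSelfAdjoint (A L w θ) := by
  have hsurj : ∀ z : ℂ, z.im ≠ 0 → ∀ v, ∃ u : (A L w θ).domain, -A L w θ u + z • u.1 = v := by
    intro z hz v
    have hz' : z ∈ Complex.slitPlane := Complex.mem_slitPlane_iff.2 (Or.inr hz)
    have hzL := notMem_spectrum_of_im_ne_zero hL hz
    obtain ⟨h, e⟩ := (isResolventAt_A hL w hz' hzL (add_Γ_ne_zero hL w θ hz' hzL hz)).1 v
    exact ⟨⟨_, h⟩, e⟩
  exact isSelfAdjoint_of_surjective (isFormalAdjoint_A hL w θ) (z := Complex.I)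
    (hsurj _ (by simp)) (hsurj _ (by simp))

end Model

end
end GeneralizedLamb

theorem mainTheorem1 {𝔥 : Type*} [NormedAddCommGroup 𝔥] [InnerProductSpace ℂ 𝔥]
    [FiniteDimensional ℂ 𝔥] [CompleteSpace 𝔥] (L : 𝔥 →ₗ[ℂ] 𝔥) (hL : L.IsSymmetric) (w : 𝔥)
    (θ : ℝ) :
    IsSelfAdjoint (GeneralizedLamb.A L w θ) ∧
    GeneralizedLamb.A₀dot L w ≤ GeneralizedLamb.A L w θ ∧
    ∀ (z : ℂ) (hz : z ∈ Complex.slitPlane), z ∉ spectrum ℂ L →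
      z ∈ GeneralizedLamb.resolventSet (GeneralizedLamb.A₀ L) ∧
      (z ∈ GeneralizedLamb.resolventSet (GeneralizedLamb.A L w θ) ↔
        (θ : ℂ) + GeneralizedLamb.Γ L w z ≠ 0) ∧
      (z ∈ GeneralizedLamb.resolventSet (GeneralizedLamb.A L w θ) →
        GeneralizedLamb.resolventOp (GeneralizedLamb.A L w θ) z =
          GeneralizedLamb.resolventOp (GeneralizedLamb.A₀ L) z +
            ((θ : ℂ) + GeneralizedLamb.Γ L w z)⁻¹ •
              InnerProductSpace.rankOne ℂ (GeneralizedLamb.G L w hz)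
                (GeneralizedLamb.G L w (GeneralizedLamb.conj_mem hz))) := by
  refine ⟨GeneralizedLamb.isSelfAdjoint_A hL w θ, GeneralizedLamb.A₀dot_le_A L w θ,
    fun z hz hzL => ?_⟩
  obtain ⟨R, hR, -⟩ := GeneralizedLamb.exists_resolvent_A₀ hL hz hzL
  have hne : z ∈ GeneralizedLamb.resolventSet (GeneralizedLamb.A L w θ) →
      (θ : ℂ) + GeneralizedLamb.Γ L w z ≠ 0 := by
    intro hρ h0
    obtain ⟨h, e⟩ := GeneralizedLamb.G_mem_eigenspace w hz hzL h0
    exact GeneralizedLamb.G_ne_zero L w hz (GeneralizedLamb.eq_zero_of_mem_resolventSet hρ e)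
  exact ⟨⟨R, hR⟩, ⟨hne, fun h0 => ⟨_, GeneralizedLamb.isResolventAt_A hL w hz hzL h0⟩⟩,
    fun hρ => GeneralizedLamb.resolventOp_eq
      (GeneralizedLamb.isResolventAt_A hL w hz hzL (hne hρ))⟩
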